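/- Let $d\ge 1$ and $n=d+1$; identify $e_n^\perp\subset\mathbb R^n$ with $\mathbb R^d$ and write $\Pi$ for the orthogonal projection onto $e_n^\perp$. **Plates.** For an axis-parallel cube $I\subset\mathbb R^d$ with center $c_I$ and sidelength $\ell_I$, a bounded interval $K\subset\mathbb R$ with $0<|K|\le \ell_I$, and $v\in\mathbb S^d$, the $d$-plate with orientation $v$, basis $I$ and height $K$ is $$P(I,K,v)=\bigcup_{t\in K}\{y\in v^\perp+(c_I,t):\ \Pi y\in I\}.$$ Let $\mathcal P_v$ be the collection of all plates with orientation $v$. For a finite set $V\subset \mathbb S^d$ and a dyadic grid $\mathcal D$ of (half-open) cubes in $\mathbb R^d$, let $\mathcal D_V$ be the collection of all plates with orientation in $V$ and basis in $\mathcal D$. For a collection of plates $\mathcal Q$ let $\mathcal Q_v=\mathcal Q\cap\mathcal P_v$, $\mathsf{sh}(\mathcal Q)=\bigcup_{Q\in\mathcal Q}Q$, and $$\widehat{\mathcal Q}=\{(1+s)Q:\ Q\in\mathcal Q,\ s\in\mathbb N,\ 1\le s\le 100n\},$$ where $rP(I,K,v)=P(rI,rK,v)$ with $rI$ and $rK$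 the concentric dilates. Put $$\mathrm M_{\mathcal Q}f(x)=\sup_{Q\in\mathcal Q}\Big(\frac1{|Q|}\int_Q|f|\Big)\mathbf 1_Q(x).$$ **Carleson sequences.** A family $a=\{a_Q\}_{Q\in\mathcal D_V}$ of non-negative numbers is a (directional) Carleson sequence if $\sum_{Q\in\mathcal D_V}a_Q<\infty$ and, for every $v\in V$, every $\mathcal T\subset\mathcal P_v$ and every $\mathcal L\subset\mathcal D_V$ such that each $L\in\mathcal L$ is contained in some $T\in\mathcal T$, $$\sum_{L\in\mathcal L}a_L\le|\mathsf{sh}(\mathcal T)|.$$ For $\mathcal Q\subseteq\mathcal D_V$ set $\mathsf{mass}_a(\mathcal Q)=\sum_{Q\in\mathcal Q}a_Q$ and $T_{\mathcal Q}(a)=\sum_{Q\in\mathcal Q}a_Q\mathbf 1_Q/|Q|$. **Theorem.** Let $\eta>0$ and $A\ge 0$. There is a constant $C=C(d,\eta,A)$ with the following property. Let $V\subset\mathbb S^d$ be a finite set with $\#V\ge 2$ and $\langle v,e_n\rangle\ge\eta$ for all $v\in V$, let $\mathcal D$ be a dyadic grid in $\mathbb R^d$, and let $\mathcal Q\subseteq\mathcal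 D_V$ be a collection of $d$-plates such that $$\sup_{v\in V}\big\|\mathrm M_{\widehat{\mathcal Q}_v}:L^1(\mathbb R^n)\to L^{1,\infty}(\mathbb R^n)\big\|\le A,$$ where $\widehat{\mathcal Q}_v=\widehat{\mathcal Q_v}$. Then for every Carleson sequence $a=\{a_Q\}_{Q\in\mathcal D_V}$, $$\|T_{\mathcal Q}(a)\|_{L^2(\mathbb R^n)}\le C\,(\log\#V)^{\frac12}\,\mathsf{mass}_a(\mathcal Q)^{\frac12}.$$ -/

import Mathlib

open MeasureTheory
open scoped ENNReal NNReal

noncomputable section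

namespace PlateCarleson

/-- The ambient space `ℝⁿ`, `n = d + 1`; the distinguished vector `eₙ` is the last
coordinate vector and `eₙ^⊥` is identified with `ℝ^d` through the first `d` coordinates. -/
abbrev E (d : ℕ) : Type := EuclideanSpace ℝ (Fin (d + 1))

/-- The unit sphere `𝕊^d ⊂ ℝ^{d+1}`. -/
abbrev Dir (d : ℕ) : Type := Metric.sphere (0 : E d) 1

/-- The orthogonal projection onto `eₙ^⊥ ≃ ℝ^d`. -/
def proj {d : ℕ} (y : E d) : Fin d → ℝ := fun i => y i.castSucc

/-- The point `(c, t) ∈ ℝ^d × ℝ = ℝ^{d+1}`. -/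
def pt {d : ℕ} (c : Fin d → ℝ) (t : ℝ) : E d :=
  WithLp.toLp 2 (Fin.snoc (α := fun _ => ℝ) c t)

/-- An axis-parallel cube in `ℝ^d`, given by its center and sidelength. -/
structure Cube (d : ℕ) where
  center : Fin d → ℝ
  side : ℝ
  side_pos : 0 < side

/-- The (half-open) cube as a set. -/
def Cube.toSet {d : ℕ} (I : Cube d) : Set (Fin d → ℝ) :=
  {x | ∀ i, x i ∈ Set.Ico (I.center i - I.side / 2) (I.center i + I.side / 2)}

/-- A dyadic grid in `ℝ^d`: the sidelengths are integer powers of `2`, the cubes of each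
generation partition `ℝ^d`, and two cubes that meet are nested. -/
structure IsDyadicGrid {d : ℕ} (𝒟 : Set (Cube d)) : Prop where
  side_eq : ∀ I ∈ 𝒟, ∃ k : ℤ, I.side = (2 : ℝ) ^ k
  partition : ∀ (k : ℤ) (x : Fin d → ℝ), ∃! I : Cube d,
    I ∈ 𝒟 ∧ I.side = (2 : ℝ) ^ k ∧ x ∈ I.toSet
  nested : ∀ I ∈ 𝒟, ∀ J ∈ 𝒟, (I.toSet ∩ J.toSet).Nonempty →
    I.toSet ⊆ J.toSet ∨ J.toSet ⊆ I.toSet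

/-- A `d`-plate `P(I, K, v)`: basis `I`, orientation `v` and height `K`, where `K` is a
nondegenerate bounded interval (with or without its endpoints `lo < hi`) of length at most
the sidelength of `I`. -/
@[ext]
structure Plate (d : ℕ) where
  basis : Cube d
  K : Set ℝ
  lo : ℝ
  hi : ℝ
  lo_lt_hi : lo < hi
  Ioo_subset : Set.Ioo lo hi ⊆ K
  subset_Icc : K ⊆ Set.Icc lo hi
  length_le : hi - lo ≤ basis.side
  dir : Dir d

namespace Plate

variable {d : ℕ}

/-- The slice `p(I, t, v) = {y ∈ v^⊥ + (c_I, t) : Π y ∈ I}`. -/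
def slice (Q : Plate d) (t : ℝ) : Set (E d) :=
  {y | inner ℝ (Q.dir : E d) (y - pt Q.basis.center t) = 0 ∧ proj y ∈ Q.basis.toSet}

/-- The plate as a subset of `ℝ^{d+1}`. -/
def toSet (Q : Plate d) : Set (E d) := ⋃ t ∈ Q.K, Q.slice t

/-- The center of the height interval. -/
def midK (Q : Plate d) : ℝ := (Q.lo + Q.hi) / 2

/-- The dilate `r Q` of a plate about its center: both the basis and the height are dilated
by the factor `r` about their centers. -/
def dilate (Q : Plate d) (r : ℝ) (hr : 0 < r) : Plate d where
  basis := ⟨Q.basis.center, r * Q.basis.side, mul_pos hr Q.basis.side_pos⟩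
  K := (fun t => Q.midK + r * (t - Q.midK)) '' Q.K
  lo := Q.midK + r * (Q.lo - Q.midK)
  hi := Q.midK + r * (Q.hi - Q.midK)
  lo_lt_hi := by
    have := mul_lt_mul_of_pos_left Q.lo_lt_hi hr
    linarith
  Ioo_subset := by
    intro y hy
    have hy1 : r * (Q.lo - Q.midK) < y - Q.midK := by linarith [hy.1]
    have hy2 : y - Q.midK < r * (Q.hi - Q.midK) := by linarith [hy.2]
    refine ⟨Q.midK + (y - Q.midK) / r, Q.Ioo_subset ⟨?_, ?_⟩, ?_⟩
    · have := (lt_div_iff₀' hr).2 hy1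
      linarith
    · have := (div_lt_iff₀' hr).2 hy2
      linarith
    · simp only [add_sub_cancel_left]
      field_simp
      ring
  subset_Icc := by
    rintro _ ⟨t, ht, rfl⟩
    have h := Q.subset_Icc ht
    have h1 := mul_le_mul_of_nonneg_left h.1 hr.le
    have h2 := mul_le_mul_of_nonneg_left h.2 hr.le
    constructor <;> simp only <;> linarith
  length_le := by
    have := mul_le_mul_of_nonneg_left Q.length_le hr.le
    simp only
    linarith
  dir := Q.dir

end Plate

variable {d : ℕ}

/-- `𝒫_v`: all plates with orientation `v`. -/
def platesDir (v : Dir d) : Set (Plate d) := {Q | Q.dir = v}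

/-- `𝒟_V`: all plates with orientation in `V` whose basis belongs to the grid `𝒟`. -/
def dyadicPlates (𝒟 : Set (Cube d)) (V : Finset (Dir d)) : Set (Plate d) :=
  {Q | Q.dir ∈ V ∧ Q.basis ∈ 𝒟}

/-- `𝒬_v`: the plates of `𝒬` with orientation `v`. -/
def withDir (𝒬 : Set (Plate d)) (v : Dir d) : Set (Plate d) := {Q ∈ 𝒬 | Q.dir = v}

/-- `𝒬̂`: the dilates `(1 + s) Q` with `Q ∈ 𝒬` and integers `1 ≤ s ≤ 100 n`, `n = d + 1`. -/
def hat (𝒬 : Set (Plate d)) : Set (Plate d) :=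
  {P | ∃ s : ℕ, 1 ≤ s ∧ s ≤ 100 * (d + 1) ∧
    ∃ Q ∈ 𝒬, P = Q.dilate (1 + (s : ℝ)) (by positivity)}

/-- The shadow of a collection of plates. -/
def sh (𝒬 : Set (Plate d)) : Set (E d) := ⋃ Q ∈ 𝒬, Q.toSet

/-- The maximal operator `M_ℒ f (x) = sup_{L ∈ ℒ} (⨍_L |f|) 1_L(x)`. -/
def maximalOp (ℒ : Set (Plate d)) (f : E d → ℝ) (x : E d) : ℝ≥0∞ :=
  ⨆ L ∈ ℒ, L.toSet.indicator (fun _ => (∫⁻ y in L.toSet, ‖f y‖ₑ) / volume L.toSet) x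

/-- `‖T : L¹(ℝⁿ) → L^{1,∞}(ℝⁿ)‖ ≤ A`. -/
def WeakTypeOneOne (T : (E d → ℝ) → E d → ℝ≥0∞) (A : ℝ≥0) : Prop :=
  ∀ f : E d → ℝ, Integrable f → ∀ t : ℝ≥0, 0 < t →
    (t : ℝ≥0∞) * volume {x | (t : ℝ≥0∞) < T f x} ≤ A * ∫⁻ x, ‖f x‖ₑ

/-- `ℒ` is subordinate to `𝒯`: each plate of `ℒ` is contained in some plate of `𝒯`. -/
def Subordinate (ℒ 𝒯 : Set (Plate d)) : Prop := ∀ L ∈ ℒ, ∃ T ∈ 𝒯, L.toSet ⊆ T.toSet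

/-- `mass_a(𝒬) = ∑_{Q ∈ 𝒬} a_Q`. -/
def mass (a : Plate d → ℝ≥0) (𝒬 : Set (Plate d)) : ℝ≥0∞ := ∑' Q : 𝒬, (a Q : ℝ≥0∞)

/-- `a` is a directional Carleson sequence over `𝒟_V` (only its values on `𝒟_V` matter). -/
structure IsCarleson (𝒟 : Set (Cube d)) (V : Finset (Dir d)) (a : Plate d → ℝ≥0) : Prop where
  mass_le : ∀ v ∈ V, ∀ 𝒯 ⊆ platesDir v, ∀ ℒ ⊆ dyadicPlates 𝒟 V, Subordinate ℒ 𝒯 →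
    mass a ℒ ≤ volume (sh 𝒯)
  mass_lt_top : mass a (dyadicPlates 𝒟 V) < ∞

/-- The balayage `T_𝒬(a)(x) = ∑_{Q ∈ 𝒬} a_Q 1_Q(x) / |Q|`. -/
def balayage (a : Plate d → ℝ≥0) (𝒬 : Set (Plate d)) (x : E d) : ℝ≥0∞ :=
  ∑' Q : 𝒬, Q.1.toSet.indicator (fun _ => (a Q : ℝ≥0∞) / volume Q.1.toSet) x

end PlateCarleson

end

noncomputable section

namespace PlateCarleson

open Classical

variable {d : ℕ}

/-! Expand the square of the balayage of a finite collection. Two plates that meet have nested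
bases, so by symmetry the integral is at most twice the sum of a_R times `avgBelow`, the average
over R of the balayage of the plates with basis inside that of R. The main point is that, for each
fixed direction v, the mass of the plates R of direction v with `avgBelow` > Λ(k+1) is at most
2^{-k} times the total mass (`sum_large_avgBelow_le`). Summing this distribution over V, the levels
below N cost ΛN times the mass, and the tails cost Λ #V 2^{-N} times the mass; N ≈ log₂ #V gives the
logarithm.

For the exponential decay, shear so that v-plates become boxes while all other plates stay convex.
Consider the averages of the balayage over the basis of R at a fixed height. Around the height of R,
take the last scale r at which these horizontal averages are large on a fixed proportion of the
interval. At scale 4r there are heights on both sides of R with small averages. A convex plate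
leaving the 9r-box has sections at R controlled by its sections at one of those heights, so such
plates contribute O(1). The remaining plates lie in the 9r-box, as does R (`avg_dichotomy`).

The union of all these boxes has small measure: the dyadic weak type bound on horizontal slices and
a Vitali covering on vertical lines bound it by half the mass. The Carleson condition, tested on
this union, says that the plates inside it carry at most half the mass (`sum_concentrated_le`).
Iterating gives the decay. -/

/-! ### Cubes -/

lemma Cube.toSet_eq_pi (I : Cube d) : I.toSet = Set.univ.pi fun i =>
    Set.Ico (I.center i - I.side / 2) (I.center i + I.side / 2) := by
  ext x; simp [Cube.toSet, Set.mem_pi]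

lemma Cube.measurableSet_toSet (I : Cube d) : MeasurableSet I.toSet := by
  rw [I.toSet_eq_pi]
  exact MeasurableSet.univ_pi fun _ => measurableSet_Ico

lemma Cube.convex_toSet (I : Cube d) : Convex ℝ I.toSet := by
  rw [I.toSet_eq_pi]
  exact convex_pi fun _ _ => convex_Ico _ _

lemma Cube.volume_toSet (I : Cube d) : volume I.toSet = ENNReal.ofReal (I.side ^ d) := by
  rw [I.toSet_eq_pi, Real.volume_pi_Ico]
  have : ∀ i : Fin d, I.center i + I.side / 2 - (I.center i - I.side / 2) = I.side := by
    intro i; ring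
  simp only [this, Finset.prod_const, Finset.card_univ, Fintype.card_fin]
  rw [ENNReal.ofReal_pow I.side_pos.le]

lemma Cube.volume_pos (I : Cube d) : volume I.toSet ≠ 0 := by
  rw [I.volume_toSet]
  have := pow_pos I.side_pos d
  simpa using this

lemma Cube.volume_ne_top (I : Cube d) : volume I.toSet ≠ ∞ := by
  rw [I.volume_toSet]; exact ENNReal.ofReal_ne_top

lemma Cube.center_mem (I : Cube d) : I.center ∈ I.toSet := by
  intro i
  have := I.side_pos
  constructor <;> linarith

/-- The concentric dilate of a cube. -/
def Cube.scale (I : Cube d) (r : ℝ) (hr : 0 < r) : Cube d :=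
  ⟨I.center, r * I.side, mul_pos hr I.side_pos⟩

lemma Cube.subset_scale (I : Cube d) {r : ℝ} (hr : 1 ≤ r) :
    I.toSet ⊆ (I.scale r (by linarith)).toSet := by
  intro x hx i
  have h := hx i
  have : I.side ≤ r * I.side := le_mul_of_one_le_left I.side_pos.le hr
  simp only [Cube.scale, Set.mem_Ico] at h ⊢
  constructor <;> linarith [h.1, h.2]

/-! ### Boxes and horizontal sections of convex sets -/

/-- The product of a cube with an open interval. -/
def box (I : Cube d) (τ r : ℝ) : Set ((Fin d → ℝ) × ℝ) := I.toSet ×ˢ Metric.ball τ r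

lemma volume_box (I : Cube d) (τ r : ℝ) :
    volume (box I τ r) = ENNReal.ofReal (I.side ^ d * (2 * r)) := by
  rw [box, Measure.volume_eq_prod, Measure.prod_prod, I.volume_toSet, Real.volume_ball,
    ENNReal.ofReal_mul (pow_nonneg I.side_pos.le d)]

/-- The measure of the horizontal section of a set at height `t`. -/
def sec (S : Set ((Fin d → ℝ) × ℝ)) (t : ℝ) : ℝ≥0∞ := volume ((fun x => (x, t)) ⁻¹' S)

lemma measurable_sec {S : Set ((Fin d → ℝ) × ℝ)} (hS : MeasurableSet S) : Measurable (sec S) :=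
  measurable_measure_prodMk_right hS

lemma lintegral_sec {S : Set ((Fin d → ℝ) × ℝ)} (hS : MeasurableSet S) :
    ∫⁻ t, sec S t = volume S := by
  rw [Measure.volume_eq_prod, Measure.prod_apply_symm hS]; rfl

/-- Contracting a convex set towards one of its points, the sections shrink by a controlled
factor. -/
lemma sec_le_of_convex {S : Set ((Fin d → ℝ) × ℝ)} (hS : Convex ℝ S) {p : (Fin d → ℝ) × ℝ}
    (hp : p ∈ S) {σ : ℝ} (h0 : 0 ≤ σ) (h1 : σ ≤ 1 / 2) (s : ℝ) :
    sec S s ≤ 2 ^ d * sec S ((1 - σ) * s + σ * p.2) := by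
  -- By convexity, shrinking the section at height `s` towards `p.1` by the ratio 1 - σ ≥ 1/2 lands
  -- in the section at the intermediate height; the volume loses at most a factor 2^d.
  have hsub : (AffineMap.homothety p.1 (1 - σ)) '' ((fun x => (x, s)) ⁻¹' S) ⊆
      (fun x => (x, (1 - σ) * s + σ * p.2)) ⁻¹' S := by
    rintro _ ⟨x, hx, rfl⟩
    have := hS hx hp (by linarith : (0 : ℝ) ≤ 1 - σ) h0 (by ring)
    simp only [Set.mem_preimage]
    convert this using 1
    ext i
    · simp [AffineMap.homothety_apply]; ring
    · simp
  have h := measure_mono (μ := volume) hsub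
  rw [Measure.addHaar_image_homothety] at h
  have hc : (2 : ℝ≥0∞)⁻¹ ^ d ≤ ENNReal.ofReal |(1 - σ) ^ Module.finrank ℝ (Fin d → ℝ)| := by
    rw [abs_of_nonneg (pow_nonneg (by linarith) _), Module.finrank_fin_fun,
      ENNReal.ofReal_pow (by linarith)]
    gcongr
    rw [← ENNReal.ofReal_ofNat, ← ENNReal.ofReal_inv_of_pos (by norm_num)]
    exact ENNReal.ofReal_le_ofReal (by linarith)
  calc sec S s = 2 ^ d * ((2 : ℝ≥0∞)⁻¹ ^ d * sec S s) := by
        rw [← mul_assoc, ← mul_pow, ENNReal.mul_inv_cancel (by norm_num) (by norm_num), one_pow,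
          one_mul]
    _ ≤ _ := by
        gcongr
        exact (mul_le_mul_left hc _).trans h

/-! ### Covering lemmas and the choice of scale -/

/-- Dilates of balls of the line that meet a set in a large proportion are controlled by the
set. -/
lemma volume_iUnion_dilate_le {A : Set ℝ} (hA : MeasurableSet A) {F : Set (ℝ × ℝ)} {R : ℝ}
    (hF : ∀ q ∈ F, 0 < q.2 ∧ q.2 ≤ R ∧
      ENNReal.ofReal (q.2 / 2) ≤ volume (A ∩ Metric.ball q.1 q.2)) :
    volume (⋃ q ∈ F, Metric.ball q.1 (9 * q.2)) ≤ 180 * volume A := by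
  -- Vitali is applied to the 9-fold dilates: once these are disjoint, so are the original balls.
  -- The 5-fold enlargements have length 90 q.2 = 180 · (q.2 / 2), whence the constant.
  obtain ⟨u, huF, hdis, hcov⟩ :=
    Vitali.exists_disjoint_subfamily_covering_enlargement_closedBall F (fun q => q.1)
      (fun q => 9 * q.2) (9 * R) (fun q hq => by linarith [(hF q hq).2.1]) 5 (by norm_num)
  have hdis' : u.PairwiseDisjoint fun q => Metric.ball q.1 q.2 := by
    refine hdis.mono_on fun q hq => ?_
    have := (hF q (huF hq)).1
    exact (Metric.ball_subset_closedBall).trans (Metric.closedBall_subset_closedBall (by linarith))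
  have hcount : u.Countable := hdis'.countable_of_isOpen (fun _ _ => Metric.isOpen_ball)
    (fun q hq => Metric.nonempty_ball.2 (hF q (huF hq)).1)
  calc volume (⋃ q ∈ F, Metric.ball q.1 (9 * q.2))
      ≤ volume (⋃ q ∈ u, Metric.closedBall q.1 (5 * (9 * q.2))) := by
        refine measure_mono (Set.iUnion₂_subset fun q hq => ?_)
        obtain ⟨b, hb, hsub⟩ := hcov q hq
        exact (Metric.ball_subset_closedBall.trans hsub).trans
          (Set.subset_biUnion_of_mem (u := fun q : ℝ × ℝ =>
            Metric.closedBall q.1 (5 * (9 * q.2))) hb)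
    _ ≤ ∑' q : u, volume (Metric.closedBall q.1.1 (5 * (9 * q.1.2))) :=
        measure_biUnion_le _ hcount _
    _ ≤ ∑' q : u, 180 * volume (A ∩ Metric.ball q.1.1 q.1.2) := by
        refine ENNReal.tsum_le_tsum fun q => ?_
        have h := hF q (huF q.2)
        rw [Real.volume_closedBall]
        calc ENNReal.ofReal (2 * (5 * (9 * q.1.2))) = 180 * ENNReal.ofReal (q.1.2 / 2) := by
              rw [← ENNReal.ofReal_ofNat 180, ← ENNReal.ofReal_mul (by norm_num)]
              congr 1; ring
          _ ≤ _ := by gcongr; exact h.2.2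
    _ = 180 * volume (⋃ q ∈ u, A ∩ Metric.ball q.1 q.2) := by
        rw [ENNReal.tsum_mul_left, measure_biUnion hcount
          (hdis'.mono fun q => Set.inter_subset_right)
          (fun q _ => hA.inter measurableSet_ball)]
    _ ≤ 180 * volume A := by
        gcongr
        exact Set.iUnion₂_subset fun q _ => Set.inter_subset_left

/-- The weak type bound for the maximal function of a finite nested family. -/
lemma volume_iUnion_nested_le {ι κ X : Type*} [MeasurableSpace X] {μ : Measure X}
    (R : Finset κ) (I : κ → Set X)
    (hnest : ∀ r ∈ R, ∀ r' ∈ R, (I r ∩ I r').Nonempty → I r ⊆ I r' ∨ I r' ⊆ I r)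
    (𝓛 : Finset ι) (J : ι → Set X) (hJ : ∀ L ∈ 𝓛, (J L).Nonempty) (w : ι → ℝ≥0∞) (lam : ℝ≥0∞)
    (hR : ∀ r ∈ R, lam * μ (I r) ≤ ∑ L ∈ 𝓛 with J L ⊆ I r, w L) :
    lam * μ (⋃ r ∈ R, I r) ≤ ∑ L ∈ 𝓛, w L := by
  set 𝓘 : Finset (Set X) := R.image I
  -- The maximal sets cover the union and are disjoint by nestedness, so each nonempty `J L` lies in
  -- at most one of them and its weight is counted at most once.
  set 𝓜 : Finset (Set X) := 𝓘.filter (fun S => ∀ S' ∈ 𝓘, S ⊆ S' → S' = S) with h𝓜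
  have hcov : (⋃ r ∈ R, I r) ⊆ ⋃ S ∈ 𝓜, S := by
    refine Set.iUnion₂_subset fun r hr => ?_
    obtain ⟨S, hrS, hS⟩ := 𝓘.exists_le_maximal (Finset.mem_image_of_mem I hr)
    have hSM : S ∈ 𝓜 := by
      rw [h𝓜, Finset.mem_filter]
      exact ⟨hS.1, fun S' hS' hle => le_antisymm (hS.2 hS' hle) hle⟩
    exact Set.Subset.trans hrS (Set.subset_biUnion_of_mem (u := fun S : Set X => S) hSM)
  have hdis : ∀ S ∈ 𝓜, ∀ S' ∈ 𝓜, (S ∩ S').Nonempty → S = S' := by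
    intro S hS S' hS' hne
    rw [h𝓜, Finset.mem_filter] at hS hS'
    obtain ⟨r, hr, rfl⟩ := Finset.mem_image.1 hS.1
    obtain ⟨r', hr', rfl⟩ := Finset.mem_image.1 hS'.1
    rcases hnest r hr r' hr' hne with h | h
    · exact (hS.2 _ hS'.1 h).symm
    · exact hS'.2 _ hS.1 h
  calc lam * μ (⋃ r ∈ R, I r) ≤ lam * ∑ S ∈ 𝓜, μ S := by
        gcongr
        exact (measure_mono hcov).trans (measure_biUnion_finset_le _ _)
    _ = ∑ S ∈ 𝓜, lam * μ S := Finset.mul_sum _ _ _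
    _ ≤ ∑ S ∈ 𝓜, ∑ L ∈ 𝓛 with J L ⊆ S, w L := by
        refine Finset.sum_le_sum fun S hS => ?_
        obtain ⟨r, hr, rfl⟩ := Finset.mem_image.1 (Finset.mem_filter.1 hS).1
        exact hR r hr
    _ = ∑ L ∈ 𝓜.biUnion (fun S => 𝓛.filter (fun L => J L ⊆ S)), w L := by
        rw [Finset.sum_biUnion]
        intro S hS S' hS' hne
        refine Finset.disjoint_left.2 fun L hL hL' => hne ?_
        rw [Finset.mem_filter] at hL hL'
        obtain ⟨x, hx⟩ := hJ L hL.1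
        exact hdis S hS S' hS' ⟨x, hL.2 hx, hL'.2 hx⟩
    _ ≤ ∑ L ∈ 𝓛, w L := by
        refine Finset.sum_le_sum_of_subset ?_
        intro L hL
        obtain ⟨S, _, h⟩ := Finset.mem_biUnion.1 hL
        exact (Finset.mem_filter.1 h).1

/-- The last scale `r = 4 ^ j * ρ` at which a property that fails at large scales holds. -/
lemma exists_last_scale {ℓ : ℝ} {p : ℝ → Prop} (hp : ∀ r, ℓ < 18 * r → 2 * r ≤ ℓ → ¬ p r) :
    ∀ (n : ℕ) (ρ : ℝ), 0 < ρ → ℓ < 4 ^ n * ρ → 18 * ρ ≤ ℓ →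
      ∃ r, ρ ≤ r ∧ 18 * r ≤ ℓ ∧ ¬ p (4 * r) ∧ (p r ∨ r = ρ)
  | 0, ρ, h0, h1, h2 => by simp at h1; linarith
  | n + 1, ρ, h0, h1, h2 => by
    by_cases h : p (4 * ρ)
    · have h18 : 18 * (4 * ρ) ≤ ℓ := by
        -- Otherwise 4ρ would lie in (ℓ/18, ℓ/2], where `p` fails: 8ρ ≤ ℓ follows from 18ρ ≤ ℓ.
        by_contra! hc
        exact hp _ hc (by linarith) h
      obtain ⟨r, hr1, hr2, hr3, hr4⟩ := exists_last_scale hp n (4 * ρ) (by linarith)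
        (by rw [pow_succ] at h1; linarith) h18
      refine ⟨r, by linarith, hr2, hr3, Or.inl ?_⟩
      rcases hr4 with h4 | rfl
      · exact h4
      · exact h
    · exact ⟨ρ, le_rfl, h2, h, Or.inr rfl⟩

/-! ### The abstract plate system -/

/-- A finite weighted system of convex sets over cubes, with a Carleson condition relative to
boxes and a distinguished nested subfamily `rect` of boxes. -/
structure PlateSystem (d : ℕ) (ι : Type*) (D : ℝ) where
  base : ι → Cube d
  S : ι → Set ((Fin d → ℝ) × ℝ)
  a : ι → ℝ≥0∞
  rect : Finset ι
  mid : ι → ℝ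
  rad : ι → ℝ
  D_nonneg : 0 ≤ D
  meas : ∀ L, MeasurableSet (S L)
  conv : ∀ L, Convex ℝ (S L)
  fst_mem : ∀ L, ∀ p ∈ S L, p.1 ∈ (base L).toSet
  vol_ne_zero : ∀ L, volume (S L) ≠ 0
  vol_ne_top : ∀ L, volume (S L) ≠ ∞
  diam_le : ∀ L, ∀ R ∈ rect, (base L).toSet ⊆ (base R).toSet → ∀ p ∈ S L, ∀ q ∈ S L,
    |p.2 - q.2| ≤ D * (base R).side
  carleson : ∀ (𝓛 : Finset ι) (𝒯 : Set (Cube d × ℝ × ℝ)),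
    (∀ T ∈ 𝒯, 0 < T.2.2 ∧ 2 * T.2.2 ≤ T.1.side) →
    (∀ L ∈ 𝓛, ∃ T ∈ 𝒯, S L ⊆ box T.1 T.2.1 T.2.2) →
    ∑ L ∈ 𝓛, a L ≤ volume (⋃ T ∈ 𝒯, box T.1 T.2.1 T.2.2)
  rad_pos : ∀ R ∈ rect, 0 < rad R
  rad_le : ∀ R ∈ rect, 2 * rad R ≤ (base R).side
  rect_subset : ∀ R ∈ rect, ∀ p ∈ S R, |p.2 - mid R| ≤ rad R
  vol_rect : ∀ R ∈ rect, volume (S R) = ENNReal.ofReal ((base R).side ^ d * (2 * rad R))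
  nested : ∀ R ∈ rect, ∀ R' ∈ rect, ((base R).toSet ∩ (base R').toSet).Nonempty →
    (base R).toSet ⊆ (base R').toSet ∨ (base R').toSet ⊆ (base R).toSet

namespace PlateSystem

variable {ι : Type*} {D : ℝ} (P : PlateSystem d ι D)

/-- The density of the mass on a plate. -/
def w (L : ι) : ℝ≥0∞ := P.a L / volume (P.S L)

/-- The plates of `𝓛` whose basis lies below that of `R`. -/
def below (𝓛 : Finset ι) (R : ι) : Finset ι :=
  𝓛.filter fun L => (P.base L).toSet ⊆ (P.base R).toSet

/-- The horizontal averages at height `t` over the basis of `R`. -/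
def f (𝓛 : Finset ι) (R : ι) (t : ℝ) : ℝ≥0∞ :=
  (∑ L ∈ P.below 𝓛 R, P.w L * sec (P.S L) t) / volume (P.base R).toSet

/-- The average over `R` of the balayage of the plates of `𝓛` below `R`. -/
def avg (𝓛 : Finset ι) (R : ι) : ℝ≥0∞ :=
  ∑ L ∈ P.below 𝓛 R, P.w L * (volume (P.S L ∩ P.S R) / volume (P.S R))

/-- The threshold for the horizontal averages. -/
def thr (d : ℕ) (D : ℝ) : ℝ := 360 + 36 * (2 * D + 2) ^ (d + 1)

/-- The threshold for the averages over plates. -/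
def bigThr (d : ℕ) (D : ℝ) : ℝ := 9 + 9 * (2 * D + 2) ^ (d + 1) + 2 ^ d * (2 * thr d D)

lemma growth_pos (P : PlateSystem d ι D) : 0 < (2 * D + 2) ^ (d + 1) := by
  have := P.D_nonneg
  positivity

/-- The set where the horizontal averages are large. -/
def high (𝓛 : Finset ι) (R : ι) : Set ℝ := {t | ENNReal.ofReal (thr d D) < P.f 𝓛 R t}

/-- The interval of center `τ` and radius `r` meets `high` in a large proportion. -/
def Dense (𝓛 : Finset ι) (R : ι) (τ r : ℝ) : Prop :=
  ENNReal.ofReal (r / 2) ≤ volume (P.high 𝓛 R ∩ Metric.ball τ r)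

lemma thr_pos (P : PlateSystem d ι D) : 0 < thr d D := by
  have := P.growth_pos
  unfold thr; linarith

lemma measurable_f (𝓛 : Finset ι) (R : ι) : Measurable (P.f 𝓛 R) := by
  unfold f
  refine Measurable.div_const (Finset.measurable_sum _ fun L _ => ?_) _
  exact (measurable_sec (P.meas L)).const_mul _

lemma measurableSet_high (𝓛 : Finset ι) (R : ι) : MeasurableSet (P.high 𝓛 R) :=
  measurableSet_lt measurable_const (P.measurable_f 𝓛 R)

lemma w_mul_volume (L : ι) : P.w L * volume (P.S L) = P.a L :=
  ENNReal.div_mul_cancel (P.vol_ne_zero L) (P.vol_ne_top L)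

/-! ### Local bounds for horizontal averages -/

/-- By `diam_le` these plates extend vertically by at most D times the side of R, so a single box
contains them all. Its half-height (D + 1) · side forces the basis to be enlarged to (2D + 2) ·
side, since a plate may not be taller than it is wide. -/
lemma sum_near_le {R : ι} (hR : R ∈ P.rect) {τ r : ℝ} (hr : 2 * r ≤ (P.base R).side)
    (𝓛 : Finset ι) (h𝓛 : ∀ L ∈ 𝓛, (P.base L).toSet ⊆ (P.base R).toSet ∧
      ∃ p ∈ P.S L, |p.2 - τ| ≤ r) :
    ∑ L ∈ 𝓛, P.a L ≤ ENNReal.ofReal (((2 * D + 2) * (P.base R).side) ^ (d + 1)) := by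
  have hD := P.D_nonneg
  have hs := (P.base R).side_pos
  have h2 : 0 < 2 * D + 2 := by linarith
  have := P.carleson 𝓛 {((P.base R).scale (2 * D + 2) h2, τ, (D + 1) * (P.base R).side)} (by
    rintro _ rfl
    simp only [Cube.scale]
    exact ⟨by positivity, by linarith⟩) (by
    intro L hL
    refine ⟨_, rfl, ?_⟩
    obtain ⟨hb, p, hp, hpt⟩ := h𝓛 L hL
    intro q hq
    refine ⟨(P.base R).subset_scale (by linarith) (hb (P.fst_mem L q hq)), ?_⟩
    have h3 := P.diam_le L R hR hb q hq p hp
    rw [Metric.mem_ball, Real.dist_eq]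
    have := abs_sub_le q.2 p.2 τ
    linarith)
  refine this.trans (le_of_eq ?_)
  simp only [Set.mem_singleton_iff, Set.iUnion_iUnion_eq_left, volume_box, Cube.scale]
  congr 1
  ring

/-- Only plates reaching the given heights contribute, and integrating the weighted sections of a
plate over all heights returns its mass. -/
lemma lintegral_f_le {R : ι} (hR : R ∈ P.rect) {τ r : ℝ} (hr : 2 * r ≤ (P.base R).side)
    (𝓛 : Finset ι) :
    ∫⁻ t in Metric.ball τ r, P.f 𝓛 R t ≤
      ENNReal.ofReal ((2 * D + 2) ^ (d + 1) * (P.base R).side) := by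
  have hs := (P.base R).side_pos
  have hpp := P.growth_pos
  set 𝓝 := (P.below 𝓛 R).filter fun L => ∃ p ∈ P.S L, |p.2 - τ| ≤ r with h𝓝
  have hsum : ∑ L ∈ 𝓝, P.a L ≤ _ := P.sum_near_le hR hr 𝓝 (by
    intro L hL
    rw [h𝓝, Finset.mem_filter, below, Finset.mem_filter] at hL
    exact ⟨hL.1.2, hL.2⟩)
  have hterm : ∀ t ∈ Metric.ball τ r,
      ∑ L ∈ P.below 𝓛 R, P.w L * sec (P.S L) t = ∑ L ∈ 𝓝, P.w L * sec (P.S L) t := by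
    intro t ht
    rw [h𝓝, Finset.sum_filter]
    refine Finset.sum_congr rfl fun L _ => ?_
    split_ifs with h
    · rfl
    · have : sec (P.S L) t = 0 := by
        have he : (fun x => (x, t)) ⁻¹' P.S L = ∅ := by
          refine Set.eq_empty_of_forall_notMem fun x hx => h ⟨_, hx, ?_⟩
          rw [Metric.mem_ball, Real.dist_eq] at ht
          exact ht.le
        rw [sec, he, measure_empty]
      rw [this, mul_zero]
  calc ∫⁻ t in Metric.ball τ r, P.f 𝓛 R t
      = ∫⁻ t in Metric.ball τ r, (∑ L ∈ 𝓝, P.w L * sec (P.S L) t) / volume (P.base R).toSet := by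
        refine setLIntegral_congr_fun measurableSet_ball fun t ht => ?_
        simp only [f, hterm t ht]
    _ ≤ ∫⁻ t, (∑ L ∈ 𝓝, P.w L * sec (P.S L) t) / volume (P.base R).toSet :=
        setLIntegral_le_lintegral _ _
    _ = (∑ L ∈ 𝓝, P.a L) / volume (P.base R).toSet := by
        simp only [div_eq_mul_inv]
        rw [lintegral_mul_const _ (Finset.measurable_sum _ fun L _ =>
          (measurable_sec (P.meas L)).const_mul _), lintegral_finsetSum _ fun L _ =>
          (measurable_sec (P.meas L)).const_mul _]
        congr 1
        refine Finset.sum_congr rfl fun L _ => ?_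
        rw [lintegral_const_mul _ (measurable_sec (P.meas L)), lintegral_sec (P.meas L),
          w_mul_volume]
    _ ≤ _ := by
        refine ENNReal.div_le_of_le_mul (hsum.trans (le_of_eq ?_))
        rw [Cube.volume_toSet, ← ENNReal.ofReal_mul (by positivity), mul_pow,
          pow_succ (P.base R).side]
        congr 1
        ring

/-- By Chebyshev, density would give thr · r/2 ≤ (2D+2)^(d+1) · side < 18 (2D+2)^(d+1) r, which the
term 36 (2D+2)^(d+1) of `thr` rules out. -/
lemma not_dense_of_large {R : ι} (hR : R ∈ P.rect) {τ r : ℝ} (hr : 2 * r ≤ (P.base R).side)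
    (hr' : (P.base R).side < 18 * r) (𝓛 : Finset ι) : ¬ P.Dense 𝓛 R τ r := by
  intro h
  have hs := (P.base R).side_pos
  have hpp := P.growth_pos
  have hthr := P.thr_pos
  have h1 := mul_meas_ge_le_lintegral (μ := volume.restrict (Metric.ball τ r))
    (P.measurable_f 𝓛 R) (ENNReal.ofReal (thr d D))
  have h2 : volume (P.high 𝓛 R ∩ Metric.ball τ r) ≤
      (volume.restrict (Metric.ball τ r)) {t | ENNReal.ofReal (thr d D) ≤ P.f 𝓛 R t} := by
    rw [← Measure.restrict_apply (P.measurableSet_high 𝓛 R)]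
    exact measure_mono fun t (ht : _ < P.f 𝓛 R t) => le_of_lt ht
  have h3 : ENNReal.ofReal (thr d D * (r / 2)) ≤
      ENNReal.ofReal ((2 * D + 2) ^ (d + 1) * (P.base R).side) := by
    rw [ENNReal.ofReal_mul hthr.le]
    refine le_trans ?_ (h1.trans (P.lintegral_f_le hR hr 𝓛))
    gcongr
    exact le_trans h h2
  rw [ENNReal.ofReal_le_ofReal_iff (by positivity)] at h3
  unfold thr at h3
  have : (2 * D + 2) ^ (d + 1) * (P.base R).side < (2 * D + 2) ^ (d + 1) * (18 * r) :=
    mul_lt_mul_of_pos_left hr' hpp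
  nlinarith

/-! ### Contribution of far and near plates to an average -/

/-- A plate reaching far away from an interval has comparable sections near the interval, on one
of its two sides. -/
lemma sec_le_of_far {R L : ι} {r : ℝ} (hr : 0 < r)
    (hb : (P.base L).toSet ⊆ (P.base R).toSet)
    (hfar : ¬ P.S L ⊆ box (P.base R) (P.mid R) (9 * r)) {t₁ t₂ s : ℝ}
    (ht₁ : t₁ ∈ Set.Ioo (P.mid R + r) (P.mid R + 3 * r))
    (ht₂ : t₂ ∈ Set.Ioo (P.mid R - 3 * r) (P.mid R - r)) (hs : |s - P.mid R| ≤ r) :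
    sec (P.S L) s ≤ 2 ^ d * (sec (P.S L) t₁ + sec (P.S L) t₂) := by
  rw [Set.not_subset] at hfar
  obtain ⟨q, hq, hqb⟩ := hfar
  have hq9 : 9 * r ≤ |q.2 - P.mid R| := by
    by_contra! hc
    exact hqb ⟨hb (P.fst_mem L q hq), by rwa [Metric.mem_ball, Real.dist_eq]⟩
  rw [abs_le] at hs
  -- This ratio is the σ for which contraction towards `q` moves height `s` to `t`. Since `t` is
  -- within 4r of `s` and `q.2` at least 8r away on the same side, σ ≤ 1/2.
  have key : ∀ t, 0 ≤ (t - s) / (q.2 - s) → (t - s) / (q.2 - s) ≤ 1 / 2 → q.2 - s ≠ 0 →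
      sec (P.S L) s ≤ 2 ^ d * sec (P.S L) t := by
    intro t h0 h1 hne
    have := sec_le_of_convex (P.conv L) hq h0 h1 s
    have he : (1 - (t - s) / (q.2 - s)) * s + (t - s) / (q.2 - s) * q.2 = t := by
      field_simp; ring
    rwa [he] at this
  rcases le_abs.1 hq9 with h | h
  · refine (key t₁ ?_ ?_ ?_).trans (by gcongr; exact le_self_add)
    · exact div_nonneg (by linarith [ht₁.1]) (by linarith)
    · rw [div_le_iff₀ (by linarith)]; linarith [ht₁.2]
    · intro h0; linarith
  · refine (key t₂ ?_ ?_ ?_).trans (by gcongr; exact le_add_self)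
    · exact div_nonneg_of_nonpos (by linarith [ht₂.2]) (by linarith)
    · rw [div_le_iff_of_neg (by linarith)]; linarith [ht₂.1]
    · intro h0; linarith

/-- The section bound is integrated over the heights of R; their total length 2 rad cancels against
the volume of the box. -/
lemma volume_inter_le_of_far {R L : ι} (hR : R ∈ P.rect) {r : ℝ} (hr : P.rad R ≤ r)
    (hb : (P.base L).toSet ⊆ (P.base R).toSet)
    (hfar : ¬ P.S L ⊆ box (P.base R) (P.mid R) (9 * r)) {t₁ t₂ : ℝ}
    (ht₁ : t₁ ∈ Set.Ioo (P.mid R + r) (P.mid R + 3 * r))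
    (ht₂ : t₂ ∈ Set.Ioo (P.mid R - 3 * r) (P.mid R - r)) :
    volume (P.S L ∩ P.S R) / volume (P.S R) ≤
      2 ^ d * (sec (P.S L) t₁ + sec (P.S L) t₂) / volume (P.base R).toSet := by
  have hr0 := P.rad_pos R hR
  have h1 : volume (P.S L ∩ P.S R) ≤
      2 ^ d * (sec (P.S L) t₁ + sec (P.S L) t₂) * ENNReal.ofReal (2 * P.rad R) := by
    rw [← lintegral_sec ((P.meas L).inter (P.meas R)), ← Real.volume_closedBall (P.mid R),
      ← lintegral_indicator_const measurableSet_closedBall]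
    refine lintegral_mono fun s => ?_
    by_cases hs : s ∈ Metric.closedBall (P.mid R) (P.rad R)
    · rw [Set.indicator_of_mem hs]
      rw [Metric.mem_closedBall, Real.dist_eq] at hs
      refine le_trans (measure_mono fun x hx => hx.1) ?_
      exact P.sec_le_of_far (by linarith) hb hfar ht₁ ht₂ (hs.trans hr)
    · have he : (fun x => (x, s)) ⁻¹' (P.S L ∩ P.S R) = ∅ := by
        refine Set.eq_empty_of_forall_notMem fun x hx => hs ?_
        rw [Metric.mem_closedBall, Real.dist_eq]
        exact P.rect_subset R hR _ hx.2
      rw [sec, he, measure_empty]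
      exact zero_le
  rw [P.vol_rect R hR, ENNReal.ofReal_mul (pow_nonneg (P.base R).side_pos.le d),
    ← Cube.volume_toSet]
  refine ENNReal.div_le_of_le_mul (h1.trans (le_of_eq ?_))
  rw [mul_comm (volume (P.base R).toSet), div_eq_mul_inv]
  have := ENNReal.inv_mul_cancel (P.base R).volume_pos (P.base R).volume_ne_top
  calc 2 ^ d * (sec (P.S L) t₁ + sec (P.S L) t₂) * ENNReal.ofReal (2 * P.rad R)
      = 2 ^ d * (sec (P.S L) t₁ + sec (P.S L) t₂) * ENNReal.ofReal (2 * P.rad R) *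
        ((volume (P.base R).toSet)⁻¹ * volume (P.base R).toSet) := by rw [this, mul_one]
    _ = _ := by ring

/-- The interval has length 2r, half of 4r: if it consisted of high points only, scale 4r would be
dense. -/
lemma exists_low {𝓛 : Finset ι} {R : ι} {τ r x : ℝ}
    (h : ¬ P.Dense 𝓛 R τ (4 * r)) (hx : Set.Ioo x (x + 2 * r) ⊆ Metric.ball τ (4 * r)) :
    ∃ t ∈ Set.Ioo x (x + 2 * r), P.f 𝓛 R t ≤ ENNReal.ofReal (thr d D) := by
  by_contra! hc
  refine h ?_
  have hsub : Set.Ioo x (x + 2 * r) ⊆ P.high 𝓛 R ∩ Metric.ball τ (4 * r) :=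
    fun t ht => ⟨hc t ht, hx ht⟩
  refine le_trans (le_of_eq ?_) (measure_mono hsub)
  rw [Real.volume_Ioo]
  congr 1
  ring

/-- The far plates contribute a bounded amount to the averages. -/
lemma sum_far_le {R : ι} (hR : R ∈ P.rect) {r : ℝ} (hr : P.rad R ≤ r) {𝓛 : Finset ι}
    (h : ¬ P.Dense 𝓛 R (P.mid R) (4 * r)) :
    ∑ L ∈ P.below 𝓛 R with ¬ P.S L ⊆ box (P.base R) (P.mid R) (9 * r),
      P.w L * (volume (P.S L ∩ P.S R) / volume (P.S R)) ≤
        ENNReal.ofReal (2 ^ d * (2 * thr d D)) := by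
  have hr0 : 0 < r := (P.rad_pos R hR).trans_le hr
  obtain ⟨t₁, ht₁, hf₁⟩ := P.exists_low (x := P.mid R + r) h (by
    intro t ht
    rw [Metric.mem_ball, Real.dist_eq, abs_lt]
    constructor <;> linarith [ht.1, ht.2])
  obtain ⟨t₂, ht₂, hf₂⟩ := P.exists_low (x := P.mid R - 3 * r) h (by
    intro t ht
    rw [Metric.mem_ball, Real.dist_eq, abs_lt]
    constructor <;> linarith [ht.1, ht.2])
  have ht₁' : t₁ ∈ Set.Ioo (P.mid R + r) (P.mid R + 3 * r) := ⟨ht₁.1, by linarith [ht₁.2]⟩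
  have ht₂' : t₂ ∈ Set.Ioo (P.mid R - 3 * r) (P.mid R - r) := ⟨ht₂.1, by linarith [ht₂.2]⟩
  calc _ ≤ ∑ L ∈ P.below 𝓛 R with ¬ P.S L ⊆ box (P.base R) (P.mid R) (9 * r),
        P.w L * (2 ^ d * (sec (P.S L) t₁ + sec (P.S L) t₂) / volume (P.base R).toSet) := by
        refine Finset.sum_le_sum fun L hL => ?_
        rw [Finset.mem_filter, below, Finset.mem_filter] at hL
        refine mul_le_mul_right ?_ _
        exact P.volume_inter_le_of_far hR hr hL.1.2 hL.2 ht₁' ht₂'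
    _ ≤ ∑ L ∈ P.below 𝓛 R,
        P.w L * (2 ^ d * (sec (P.S L) t₁ + sec (P.S L) t₂) / volume (P.base R).toSet) :=
        Finset.sum_le_sum_of_subset (Finset.filter_subset _ _)
    _ = 2 ^ d * (P.f 𝓛 R t₁ + P.f 𝓛 R t₂) := by
        simp only [f, div_eq_mul_inv, ← add_mul, ← Finset.sum_add_distrib]
        rw [Finset.sum_mul, Finset.mul_sum]
        refine Finset.sum_congr rfl fun L _ => ?_
        ring
    _ ≤ 2 ^ d * (ENNReal.ofReal (thr d D) + ENNReal.ofReal (thr d D)) := by gcongr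
    _ = _ := by
        rw [← ENNReal.ofReal_add P.thr_pos.le P.thr_pos.le, ENNReal.ofReal_mul (by positivity),
          ENNReal.ofReal_pow (by norm_num), ENNReal.ofReal_ofNat, two_mul]

/-- The crude bound of the overlap by the whole plate suffices for plates whose total mass is
controlled by a multiple of the volume of R. -/
lemma sum_inter_le {R : ι} (hR : R ∈ P.rect) (𝓝 𝓛 : Finset ι) {c m : ℝ} (hc : 0 ≤ c)
    (h : ∀ L ∈ 𝓛, (P.S L ∩ P.S R).Nonempty → L ∈ 𝓝)
    (hm : ∑ L ∈ 𝓝, P.a L ≤ ENNReal.ofReal m)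
    (hmc : m ≤ c * ((P.base R).side ^ d * (2 * P.rad R))) :
    ∑ L ∈ 𝓛, P.w L * (volume (P.S L ∩ P.S R) / volume (P.S R)) ≤ ENNReal.ofReal c := by
  calc _ ≤ ∑ L ∈ 𝓝, P.a L / volume (P.S R) := by
        have hle : ∀ L, P.w L * (volume (P.S L ∩ P.S R) / volume (P.S R)) ≤
            P.a L / volume (P.S R) := by
          intro L
          rw [← mul_div_assoc]
          gcongr
          rw [← P.w_mul_volume L]
          gcongr
          exact Set.inter_subset_left
        have hz : ∀ L ∈ 𝓛, L ∉ 𝓝 →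
            P.w L * (volume (P.S L ∩ P.S R) / volume (P.S R)) = 0 := by
          intro L hL hLN
          have : P.S L ∩ P.S R = ∅ := by
            by_contra hne
            exact hLN (h L hL (Set.nonempty_iff_ne_empty.2 hne))
          simp [this]
        calc _ = ∑ L ∈ 𝓛 with L ∈ 𝓝, P.w L * (volume (P.S L ∩ P.S R) / volume (P.S R)) := by
              symm
              refine Finset.sum_filter_of_ne fun L hL hne => ?_
              by_contra hn
              exact hne (hz L hL hn)
          _ ≤ ∑ L ∈ 𝓝, P.w L * (volume (P.S L ∩ P.S R) / volume (P.S R)) :=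
              Finset.sum_le_sum_of_subset fun L hL => (Finset.mem_filter.1 hL).2
          _ ≤ _ := Finset.sum_le_sum fun L _ => hle L
    _ = (∑ L ∈ 𝓝, P.a L) / volume (P.S R) := by
        simp only [div_eq_mul_inv, Finset.sum_mul]
    _ ≤ ENNReal.ofReal c := by
        refine ENNReal.div_le_of_le_mul (hm.trans ?_)
        rw [P.vol_rect R hR, ← ENNReal.ofReal_mul hc]
        exact ENNReal.ofReal_le_ofReal hmc

/-! ### Concentration of mass and the dichotomy -/

/-- The boxes in which the mass concentrates. -/
def fam (𝓛 : Finset ι) : Set (Cube d × ℝ × ℝ) :=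
  {T | ∃ R ∈ P.rect, ∃ r, T = (P.base R, T.2.1, 9 * r) ∧ 0 < r ∧ 18 * r ≤ (P.base R).side ∧
    P.Dense 𝓛 R T.2.1 r}

/-- The plates contained in boxes in which the mass concentrates. -/
def concentrated (𝓛 𝓛' : Finset ι) : Finset ι :=
  𝓛'.filter fun L => ∃ T ∈ P.fam 𝓛, P.S L ⊆ box T.1 T.2.1 T.2.2

/-- Here R is almost as tall as it is wide, so its volume is comparable to that of the enlarged box
of `sum_near_le`. -/
lemma avg_le_of_wide {R : ι} (hR : R ∈ P.rect) (h18 : (P.base R).side < 18 * P.rad R)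
    (𝓛 : Finset ι) : P.avg 𝓛 R ≤ ENNReal.ofReal (9 * (2 * D + 2) ^ (d + 1)) := by
  have hs := (P.base R).side_pos
  have hpp := P.growth_pos
  refine P.sum_inter_le hR
    ((P.below 𝓛 R).filter fun L => ∃ p ∈ P.S L, |p.2 - P.mid R| ≤ P.rad R) _ (by positivity)
    ?_ (P.sum_near_le hR (τ := P.mid R) (P.rad_le R hR) _ ?_) ?_
  · rintro L hL ⟨p, hp, hpR⟩
    exact Finset.mem_filter.2 ⟨hL, p, hp, P.rect_subset R hR p hpR⟩
  · intro L hL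
    rw [Finset.mem_filter, below, Finset.mem_filter] at hL
    exact ⟨hL.1.2, hL.2⟩
  · rw [mul_pow, pow_succ (P.base R).side]
    have : (2 * D + 2) ^ (d + 1) * (P.base R).side ^ d * (P.base R).side ≤
        (2 * D + 2) ^ (d + 1) * (P.base R).side ^ d * (18 * P.rad R) := by gcongr
    linarith

lemma exists_scale {R : ι} (hR : R ∈ P.rect) (h18 : 18 * P.rad R ≤ (P.base R).side)
    (𝓛 : Finset ι) : ∃ r, P.rad R ≤ r ∧ 18 * r ≤ (P.base R).side ∧
      ¬ P.Dense 𝓛 R (P.mid R) (4 * r) ∧ (P.Dense 𝓛 R (P.mid R) r ∨ r = P.rad R) := by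
  obtain ⟨n, hn⟩ := pow_unbounded_of_one_lt ((P.base R).side / P.rad R)
    (by norm_num : (1 : ℝ) < 4)
  refine exists_last_scale (fun r h1 h2 => P.not_dense_of_large hR h2 h1 𝓛) n _
    (P.rad_pos R hR) ?_ h18
  rwa [div_lt_iff₀ (P.rad_pos R hR)] at hn

/-- Either the average over `R` is bounded or `R` lies in a box of concentration outside of which
the plates contribute a bounded amount. -/
lemma avg_dichotomy {R : ι} (hR : R ∈ P.rect) (𝓛 : Finset ι) :
    P.avg 𝓛 R ≤ ENNReal.ofReal (bigThr d D) ∨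
      (R ∈ P.concentrated 𝓛 P.rect ∧
        P.avg 𝓛 R ≤ ENNReal.ofReal (bigThr d D) + P.avg (P.concentrated 𝓛 𝓛) R) := by
  have hs := (P.base R).side_pos
  have hpp := P.growth_pos
  have ht : 0 ≤ 2 ^ d * (2 * thr d D) := by have := P.thr_pos; positivity
  rcases lt_or_ge (P.base R).side (18 * P.rad R) with h18 | h18
  · left
    refine (P.avg_le_of_wide hR h18 𝓛).trans (ENNReal.ofReal_le_ofReal ?_)
    unfold bigThr; linarith
  obtain ⟨r, hr1, hr2, hr3, hr4⟩ := P.exists_scale hR h18 𝓛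
  have hr0 : 0 < r := (P.rad_pos R hR).trans_le hr1
  have hsplit : P.avg 𝓛 R = (∑ L ∈ P.below 𝓛 R with P.S L ⊆ box (P.base R) (P.mid R) (9 * r),
      P.w L * (volume (P.S L ∩ P.S R) / volume (P.S R))) +
      ∑ L ∈ P.below 𝓛 R with ¬ P.S L ⊆ box (P.base R) (P.mid R) (9 * r),
      P.w L * (volume (P.S L ∩ P.S R) / volume (P.S R)) :=
    (Finset.sum_filter_add_sum_filter_not _ _ _).symm
  have hfar := P.sum_far_le hR hr1 hr3
  -- If scale r is dense, the 9r-box belongs to `fam` and contains both R and the near plates. If r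
  -- = rad R, that box has 9 times the volume of R, and the Carleson condition bounds the near part
  -- by 9.
  rcases hr4 with hdense | rfl
  · right
    have hT : (P.base R, P.mid R, 9 * r) ∈ P.fam 𝓛 := ⟨R, hR, r, rfl, hr0, hr2, hdense⟩
    refine ⟨Finset.mem_filter.2 ⟨hR, _, hT, fun p hp => ⟨P.fst_mem R p hp, ?_⟩⟩, ?_⟩
    · rw [Metric.mem_ball, Real.dist_eq]
      have := P.rect_subset R hR p hp
      simp only
      linarith
    · rw [hsplit, add_comm]
      refine add_le_add (hfar.trans (ENNReal.ofReal_le_ofReal (by unfold bigThr; linarith))) ?_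
      refine Finset.sum_le_sum_of_subset fun L hL => ?_
      rw [Finset.mem_filter, below, Finset.mem_filter] at hL
      rw [below, Finset.mem_filter, concentrated, Finset.mem_filter]
      exact ⟨⟨hL.1.1, _, hT, hL.2⟩, hL.1.2⟩
  · left
    have hnear := P.sum_inter_le hR
      ((P.below 𝓛 R).filter fun L => P.S L ⊆ box (P.base R) (P.mid R) (9 * P.rad R))
      ((P.below 𝓛 R).filter fun L => P.S L ⊆ box (P.base R) (P.mid R) (9 * P.rad R))
      (c := 9) (m := (P.base R).side ^ d * (2 * (9 * P.rad R))) (by norm_num)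
      (fun L hL _ => hL) (by
        refine (P.carleson _ {(P.base R, P.mid R, 9 * P.rad R)} ?_ ?_).trans (le_of_eq ?_)
        · rintro _ rfl
          exact ⟨by simp only; linarith, by simp only; linarith⟩
        · intro L hL
          exact ⟨_, rfl, (Finset.mem_filter.1 hL).2⟩
        · simp only [Set.mem_singleton_iff, Set.iUnion_iUnion_eq_left, volume_box])
      (le_of_eq (by ring))
    rw [hsplit]
    refine (add_le_add hnear hfar).trans ?_
    rw [← ENNReal.ofReal_add (by norm_num) ht]
    exact ENNReal.ofReal_le_ofReal (by unfold bigThr; linarith)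

/-! ### Measure of the concentration boxes -/

/-- The points lying over a large horizontal average. -/
def highSet (𝓛 : Finset ι) : Set ((Fin d → ℝ) × ℝ) :=
  ⋃ R ∈ P.rect, (P.base R).toSet ×ˢ P.high 𝓛 R

lemma measurableSet_highSet (𝓛 : Finset ι) : MeasurableSet (P.highSet 𝓛) :=
  Finset.measurableSet_biUnion _ fun R _ =>
    (P.base R).measurableSet_toSet.prod (P.measurableSet_high 𝓛 R)

/-- At each fixed height this is the weak type bound for averages over nested bases; integrating in
the height turns sections into masses. -/
lemma volume_highSet_le (𝓛 : Finset ι) :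
    ENNReal.ofReal (thr d D) * volume (P.highSet 𝓛) ≤ ∑ L ∈ 𝓛, P.a L := by
  have hm := P.measurableSet_highSet 𝓛
  rw [← lintegral_sec hm, ← lintegral_const_mul _ (measurable_sec hm)]
  calc _ ≤ ∫⁻ t, ∑ L ∈ 𝓛, P.w L * sec (P.S L) t := by
        refine lintegral_mono fun t => ?_
        have he : (fun x => (x, t)) ⁻¹' P.highSet 𝓛 =
            ⋃ R ∈ P.rect.filter (fun R => t ∈ P.high 𝓛 R), (P.base R).toSet := by
          ext x
          simp only [highSet, Set.mem_preimage, Set.mem_iUnion, Set.mem_prod, Finset.mem_filter]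
          constructor
          · rintro ⟨R, hR, hx, ht⟩; exact ⟨R, ⟨hR, ht⟩, hx⟩
          · rintro ⟨R, ⟨hR, ht⟩, hx⟩; exact ⟨R, hR, hx, ht⟩
        simp only [sec]
        rw [he]
        refine volume_iUnion_nested_le _ _ ?_ 𝓛 (fun L => (P.base L).toSet)
          (fun L _ => ⟨_, (P.base L).center_mem⟩) _ _ ?_
        · intro R hR R' hR'
          exact P.nested R (Finset.mem_filter.1 hR).1 R' (Finset.mem_filter.1 hR').1
        · intro R hR
          have h : ENNReal.ofReal (thr d D) < P.f 𝓛 R t := (Finset.mem_filter.1 hR).2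
          exact (ENNReal.le_div_iff_mul_le (Or.inl (P.base R).volume_pos)
            (Or.inl (P.base R).volume_ne_top)).1 h.le
    _ = ∑ L ∈ 𝓛, P.a L := by
        rw [lintegral_finsetSum _ fun L _ => (measurable_sec (P.meas L)).const_mul _]
        refine Finset.sum_congr rfl fun L _ => ?_
        rw [lintegral_const_mul _ (measurable_sec (P.meas L)), lintegral_sec (P.meas L),
          w_mul_volume]

/-- On the vertical line over x, the boxes are 9-fold dilates of intervals dense in the slice of
`highSet`, whichever R with x in its basis they come from; so the one-dimensional covering lemma
handles all R at once. -/
lemma volume_fam_le (𝓛 : Finset ι) :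
    volume (⋃ T ∈ P.fam 𝓛, box T.1 T.2.1 T.2.2) ≤ 180 * volume (P.highSet 𝓛) := by
  set O : ι → Set ℝ := fun R => ⋃ q ∈ {q : ℝ × ℝ | 0 < q.2 ∧ 18 * q.2 ≤ (P.base R).side ∧
    P.Dense 𝓛 R q.1 q.2}, Metric.ball q.1 (9 * q.2) with hO
  have hOm : ∀ R, MeasurableSet (O R) := fun R =>
    (isOpen_biUnion fun q _ => Metric.isOpen_ball).measurableSet
  set U : Set ((Fin d → ℝ) × ℝ) := ⋃ R ∈ P.rect, (P.base R).toSet ×ˢ O R with hU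
  have hUm : MeasurableSet U := Finset.measurableSet_biUnion _ fun R _ =>
    (P.base R).measurableSet_toSet.prod (hOm R)
  have hGm := P.measurableSet_highSet 𝓛
  have hsub : (⋃ T ∈ P.fam 𝓛, box T.1 T.2.1 T.2.2) ⊆ U := by
    refine Set.iUnion₂_subset ?_
    rintro ⟨I, τ, r'⟩ ⟨R, hR, r, hT, h0, h18, hd⟩
    simp only [Prod.mk.injEq, true_and] at hT
    obtain ⟨rfl, rfl⟩ := hT
    rintro ⟨x, t⟩ ⟨hx, ht⟩
    simp only [hU, hO, Set.mem_iUnion, Set.mem_prod]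
    exact ⟨R, hR, hx, (τ, r), ⟨h0, h18, hd⟩, ht⟩
  refine (measure_mono hsub).trans ?_
  rw [Measure.volume_eq_prod, Measure.prod_apply hUm, Measure.prod_apply hGm,
    ← lintegral_const_mul _ (measurable_measure_prodMk_left hGm)]
  refine lintegral_mono fun x => ?_
  set F : Set (ℝ × ℝ) := {q | ∃ R ∈ P.rect, x ∈ (P.base R).toSet ∧ 0 < q.2 ∧
    18 * q.2 ≤ (P.base R).side ∧ P.Dense 𝓛 R q.1 q.2} with hF
  have hUx : Prod.mk x ⁻¹' U ⊆ ⋃ q ∈ F, Metric.ball q.1 (9 * q.2) := by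
    intro t ht
    simp only [hU, hO, Set.mem_preimage, Set.mem_iUnion, Set.mem_prod] at ht
    obtain ⟨R, hR, hx, q, ⟨h0, h18, hd⟩, htq⟩ := ht
    simp only [Set.mem_iUnion]
    exact ⟨q, ⟨R, hR, hx, h0, h18, hd⟩, htq⟩
  refine (measure_mono hUx).trans (volume_iUnion_dilate_le (measurable_prodMk_left hGm)
    (R := ∑ R ∈ P.rect, (P.base R).side) ?_)
  rintro q ⟨R, hR, hx, h0, h18, hd⟩
  refine ⟨h0, ?_, hd.trans (measure_mono ?_)⟩
  · have := Finset.single_le_sum (f := fun R => (P.base R).side)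
      (fun R _ => (P.base R).side_pos.le) hR
    linarith
  · rintro t ⟨ht, htb⟩
    refine ⟨?_, htb⟩
    simp only [highSet, Set.mem_preimage, Set.mem_iUnion, Set.mem_prod]
    exact ⟨R, hR, hx, ht⟩

/-- The Carleson condition is tested on the whole union of boxes at once. The term 360 of `thr` is
twice the covering constant 180, whence the factor 1/2. -/
lemma sum_concentrated_le (𝓛 𝓛' : Finset ι) :
    ∑ L ∈ P.concentrated 𝓛 𝓛', P.a L ≤ 2⁻¹ * ∑ L ∈ 𝓛, P.a L := by
  have h1 : ∑ L ∈ P.concentrated 𝓛 𝓛', P.a L ≤ 180 * volume (P.highSet 𝓛) := by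
    refine (P.carleson _ (P.fam 𝓛) ?_ ?_).trans (P.volume_fam_le 𝓛)
    · rintro ⟨I, τ, r'⟩ ⟨R, hR, r, hT, h0, h18, hd⟩
      simp only [Prod.mk.injEq, true_and] at hT
      obtain ⟨rfl, rfl⟩ := hT
      exact ⟨by simp only; linarith, by simp only; linarith⟩
    · intro L hL
      exact (Finset.mem_filter.1 hL).2
  have h2 : (360 : ℝ≥0∞) ≤ ENNReal.ofReal (thr d D) := by
    rw [← ENNReal.ofReal_ofNat]
    have := P.growth_pos
    exact ENNReal.ofReal_le_ofReal (by unfold thr; linarith)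
  calc _ ≤ 180 * volume (P.highSet 𝓛) := h1
    _ = 2⁻¹ * (360 * volume (P.highSet 𝓛)) := by
        rw [← mul_assoc]
        congr 1
        rw [show (360 : ℝ≥0∞) = 2 * 180 by norm_num, ← mul_assoc,
          ENNReal.inv_mul_cancel (by norm_num) (by norm_num), one_mul]
    _ ≤ 2⁻¹ * (ENNReal.ofReal (thr d D) * volume (P.highSet 𝓛)) := by gcongr
    _ ≤ _ := by gcongr; exact P.volume_highSet_le 𝓛

/-! ### Exponential decay by iteration -/

/-- The mass of the plates over which the averages are large decays exponentially. -/
theorem sum_large_avg_le (k : ℕ) (𝓛 : Finset ι) :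
    ∑ R ∈ P.rect with ENNReal.ofReal (bigThr d D) * (k + 1) < P.avg 𝓛 R, P.a R ≤
      2⁻¹ ^ k * ∑ L ∈ 𝓛, P.a L := by
  induction k generalizing 𝓛 with
  | zero =>
    calc _ ≤ ∑ R ∈ P.concentrated 𝓛 P.rect, P.a R := by
          refine Finset.sum_le_sum_of_subset fun R hR => ?_
          simp only [Finset.mem_filter, Nat.cast_zero, zero_add, mul_one] at hR
          rcases P.avg_dichotomy hR.1 𝓛 with h | h
          · exact absurd h (not_le.2 hR.2)
          · exact h.1
      _ ≤ 2⁻¹ * ∑ L ∈ 𝓛, P.a L := P.sum_concentrated_le 𝓛 _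
      _ ≤ _ := by
          gcongr
          simp
  | succ k ih =>
    -- Replacing 𝓛 by its concentrated part lowers a large average by at most one threshold and
    -- halves the mass; `rect` stays fixed throughout.
    calc _ ≤ ∑ R ∈ P.rect with
          ENNReal.ofReal (bigThr d D) * (k + 1) < P.avg (P.concentrated 𝓛 𝓛) R, P.a R := by
          refine Finset.sum_le_sum_of_subset fun R hR => ?_
          rw [Finset.mem_filter] at hR ⊢
          refine ⟨hR.1, ?_⟩
          have hlt := hR.2
          have hsum : ENNReal.ofReal (bigThr d D) * (((k + 1 : ℕ) : ℝ≥0∞) + 1) =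
              ENNReal.ofReal (bigThr d D) + ENNReal.ofReal (bigThr d D) * (k + 1) := by
            push_cast; ring
          rw [hsum] at hlt
          rcases P.avg_dichotomy hR.1 𝓛 with h | h
          · exact absurd (hlt.trans_le h) (not_lt.2 le_self_add)
          · exact (ENNReal.add_lt_add_iff_left ENNReal.ofReal_ne_top).1 (hlt.trans_le h.2)
      _ ≤ 2⁻¹ ^ k * ∑ L ∈ P.concentrated 𝓛 𝓛, P.a L := ih _
      _ ≤ 2⁻¹ ^ k * (2⁻¹ * ∑ L ∈ 𝓛, P.a L) := by gcongr; exact P.sum_concentrated_le 𝓛 𝓛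
      _ = _ := by rw [pow_succ, mul_assoc]

end PlateSystem

/-! ### Shear coordinates adapted to a direction -/

/-- The slope of the hyperplane orthogonal to `v`, as a graph over `ℝ^d`. -/
def slope (v : E d) : (Fin d → ℝ) →ₗ[ℝ] ℝ :=
  (-(v (Fin.last d))⁻¹) • ∑ i : Fin d, v i.castSucc • LinearMap.proj i

lemma slope_apply (v : E d) (x : Fin d → ℝ) :
    slope v x = -(v (Fin.last d))⁻¹ * ∑ i : Fin d, v i.castSucc * x i := by
  simp [slope, LinearMap.sum_apply]

lemma continuous_slope (v : E d) : Continuous (slope v) :=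
  LinearMap.continuous_of_finiteDimensional _

lemma abs_slope_le {η : ℝ} (hη : 0 < η) (v : Dir d) (hv : η ≤ (v : E d) (Fin.last d))
    {x : Fin d → ℝ} {b : ℝ} (hx : ∀ i, |x i| ≤ b) : |slope v x| ≤ d / η * b := by
  have hv0 : 0 < (v : E d) (Fin.last d) := hη.trans_le hv
  have hsum : |∑ i : Fin d, (v : E d) i.castSucc * x i| ≤ d * b := by
    refine (Finset.abs_sum_le_sum_abs _ _).trans ?_
    calc ∑ i : Fin d, |(v : E d) i.castSucc * x i| ≤ ∑ _i : Fin d, b := by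
          refine Finset.sum_le_sum fun i _ => ?_
          rw [abs_mul]
          have h1 : |(v : E d) i.castSucc| ≤ 1 := by
            have := PiLp.norm_apply_le (v : E d) i.castSucc
            rwa [norm_eq_of_mem_sphere v, Real.norm_eq_abs] at this
          calc _ ≤ 1 * |x i| := by gcongr
            _ ≤ b := by rw [one_mul]; exact hx i
      _ = d * b := by simp
  rw [slope_apply, abs_mul, abs_neg, abs_inv, abs_of_pos hv0, div_mul_eq_mul_div, div_eq_inv_mul]
  gcongr

/-- The coordinates in which the plates of direction `v` are products. -/
def shear (v : E d) (y : E d) : (Fin d → ℝ) × ℝ :=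
  (proj y, y (Fin.last d) - slope v (proj y))

lemma measurePreserving_shear (v : E d) : MeasurePreserving (shear v) := by
  have h1 := PiLp.volume_preserving_ofLp (Fin (d + 1))
  have h2 := volume_preserving_piFinSuccAbove (fun _ : Fin (d + 1) => ℝ) (Fin.last d)
  have h3 : MeasurePreserving (Prod.swap : ℝ × (Fin d → ℝ) → (Fin d → ℝ) × ℝ) volume volume :=
    Measure.measurePreserving_swap
  have h4 : MeasurePreserving
      (fun p : (Fin d → ℝ) × ℝ => (id p.1, p.2 - slope v p.1)) volume volume := by
    refine (MeasurePreserving.id volume).skew_product (g := fun x t => t - slope v x) ?_ ?_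
    · exact measurable_snd.sub ((continuous_slope v).measurable.comp measurable_fst)
    · exact Filter.Eventually.of_forall fun x =>
        (measurePreserving_sub_right volume (slope v x)).map_eq
  have h := h4.comp (h3.comp (h2.comp h1))
  convert h using 1
  ext y
  · rfl
  · simp [MeasurableEquiv.piFinSuccAbove, Fin.insertNthEquiv]
    rfl

/-- Stated without measurability so that it applies to arbitrary unions of boxes; a measurable hull
takes care of this. -/
lemma volume_shear_preimage_le (v : E d) (U : Set ((Fin d → ℝ) × ℝ)) :
    volume (shear v ⁻¹' U) ≤ volume U :=
  calc volume (shear v ⁻¹' U) ≤ volume (shear v ⁻¹' toMeasurable volume U) :=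
        measure_mono (Set.preimage_mono (subset_toMeasurable _ _))
    _ = volume U := by
        rw [(measurePreserving_shear v).measure_preimage
          (measurableSet_toMeasurable _ _).nullMeasurableSet, measure_toMeasurable]

namespace Plate

lemma ordConnected_K (Q : Plate d) : Q.K.OrdConnected := by
  refine ⟨fun x hx y hy z hz => ?_⟩
  rcases eq_or_lt_of_le hz.1 with rfl | h1
  · exact hx
  rcases eq_or_lt_of_le hz.2 with rfl | h2
  · exact hy
  exact Q.Ioo_subset ⟨(Q.subset_Icc hx).1.trans_lt h1, h2.trans_le (Q.subset_Icc hy).2⟩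

lemma volume_K (Q : Plate d) : volume Q.K = ENNReal.ofReal (Q.hi - Q.lo) := by
  refine le_antisymm ?_ ?_
  · rw [← Real.volume_Icc]; exact measure_mono Q.subset_Icc
  · rw [← Real.volume_Ioo]; exact measure_mono Q.Ioo_subset

/-- The plate in the coordinates adapted to `v`. -/
def sheared (v : E d) (Q : Plate d) : Set ((Fin d → ℝ) × ℝ) :=
  {p | p.1 ∈ Q.basis.toSet ∧ p.2 + slope v p.1 - slope Q.dir (p.1 - Q.basis.center) ∈ Q.K}

/-- The last coordinate of the orientation being nonzero, each point lies on the slice hyperplane of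
exactly one height t, and `key` solves for it. -/
lemma toSet_eq_preimage (v : E d) (Q : Plate d) (hQ : 0 < (Q.dir : E d) (Fin.last d)) :
    Q.toSet = shear v ⁻¹' Q.sheared v := by
  have key : ∀ (y : E d) (t : ℝ), inner ℝ (Q.dir : E d) (y - pt Q.basis.center t) = 0 ↔
      t = y (Fin.last d) - slope Q.dir (proj y - Q.basis.center) := by
    intro y t
    have : inner ℝ (Q.dir : E d) (y - pt Q.basis.center t) =
        (∑ i : Fin d, (Q.dir : E d) i.castSucc * (proj y - Q.basis.center) i) +
          (Q.dir : E d) (Fin.last d) * (y (Fin.last d) - t) := by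
      rw [PiLp.inner_apply, Fin.sum_univ_castSucc]
      simp [pt, proj, mul_comm]
    rw [this, slope_apply]
    constructor
    · intro h
      field_simp
      linarith
    · rintro rfl
      field_simp
      ring
  ext y
  simp only [toSet, slice, Set.mem_iUnion, Set.mem_ofPred_eq, key, sheared, shear,
    Set.mem_preimage, sub_add_cancel]
  constructor
  · rintro ⟨t, ht, rfl, hy⟩; exact ⟨hy, ht⟩
  · rintro ⟨hy, ht⟩; exact ⟨_, ht, rfl, hy⟩

lemma measurableSet_sheared (v : E d) (Q : Plate d) : MeasurableSet (Q.sheared v) := by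
  refine (measurable_fst Q.basis.measurableSet_toSet).inter ?_
  have : Measurable fun p : (Fin d → ℝ) × ℝ =>
      p.2 + slope v p.1 - slope Q.dir (p.1 - Q.basis.center) :=
    (measurable_snd.add ((continuous_slope v).measurable.comp measurable_fst)).sub
      ((continuous_slope (Q.dir : E d)).measurable.comp
        (measurable_fst.sub_const Q.basis.center))
  exact this Q.ordConnected_K.measurableSet

lemma convex_sheared (v : E d) (Q : Plate d) : Convex ℝ (Q.sheared v) := by
  rintro p ⟨hp1, hp2⟩ q ⟨hq1, hq2⟩ α β hα hβ hαβ
  refine ⟨Q.basis.convex_toSet hp1 hq1 hα hβ hαβ, ?_⟩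
  have := Q.ordConnected_K.convex hp2 hq2 hα hβ hαβ
  convert this using 1
  obtain rfl : β = 1 - α := by linarith
  simp only [Prod.fst_add, Prod.snd_add, Prod.smul_fst, Prod.smul_snd, map_add, map_sub, map_smul,
    smul_eq_mul]
  ring

lemma sheared_self (Q : Plate d) : Q.sheared Q.dir =
    Q.basis.toSet ×ˢ ((fun t => t + slope Q.dir Q.basis.center) ⁻¹' Q.K) := by
  ext p
  simp only [sheared, Set.mem_ofPred_eq, Set.mem_prod, Set.mem_preimage, map_sub]
  have : p.2 + slope Q.dir p.1 - (slope Q.dir p.1 - slope Q.dir Q.basis.center) =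
      p.2 + slope Q.dir Q.basis.center := by ring
  rw [this]

lemma measurableSet_toSet (Q : Plate d) (hQ : 0 < (Q.dir : E d) (Fin.last d)) :
    MeasurableSet Q.toSet := by
  rw [Q.toSet_eq_preimage Q.dir hQ]
  exact (measurePreserving_shear _).measurable (Q.measurableSet_sheared _)

lemma volume_sheared (v : E d) (Q : Plate d) (hQ : 0 < (Q.dir : E d) (Fin.last d)) :
    volume (Q.sheared v) = volume Q.toSet := by
  rw [Q.toSet_eq_preimage v hQ, (measurePreserving_shear v).measure_preimage
    (Q.measurableSet_sheared v).nullMeasurableSet]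

lemma volume_toSet (Q : Plate d) (hQ : 0 < (Q.dir : E d) (Fin.last d)) :
    volume Q.toSet = ENNReal.ofReal (Q.basis.side ^ d * (Q.hi - Q.lo)) := by
  rw [← Q.volume_sheared Q.dir hQ, sheared_self, Measure.volume_eq_prod, Measure.prod_prod,
    measure_preimage_add_right, volume_K, Cube.volume_toSet,
    ENNReal.ofReal_mul (pow_nonneg Q.basis.side_pos.le d)]

lemma volume_toSet_ne_zero (Q : Plate d) (hQ : 0 < (Q.dir : E d) (Fin.last d)) :
    volume Q.toSet ≠ 0 := by
  rw [Q.volume_toSet hQ, ← pos_iff_ne_zero, ENNReal.ofReal_pos]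
  exact mul_pos (pow_pos Q.basis.side_pos d) (sub_pos.2 Q.lo_lt_hi)

lemma volume_toSet_ne_top (Q : Plate d) (hQ : 0 < (Q.dir : E d) (Fin.last d)) :
    volume Q.toSet ≠ ∞ := by
  rw [Q.volume_toSet hQ]; exact ENNReal.ofReal_ne_top

/-- The plate of direction `v` that is a given box in the coordinates adapted to `v`. -/
def ofBox (v : Dir d) (I : Cube d) (τ r : ℝ) (h : 0 < r ∧ 2 * r ≤ I.side) : Plate d where
  basis := I
  -- Heights of a plate are read over the center of its basis, those of the shear over the origin;
  -- hence the shift.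
  K := Set.Ioo (τ + slope v I.center - r) (τ + slope v I.center + r)
  lo := τ + slope v I.center - r
  hi := τ + slope v I.center + r
  lo_lt_hi := by linarith [h.1]
  Ioo_subset := le_rfl
  subset_Icc := Set.Ioo_subset_Icc_self
  length_le := by linarith [h.2]
  dir := v

lemma toSet_ofBox (v : Dir d) (hv : 0 < (v : E d) (Fin.last d)) (I : Cube d) (τ r : ℝ)
    (h : 0 < r ∧ 2 * r ≤ I.side) : (ofBox v I τ r h).toSet = shear v ⁻¹' box I τ r := by
  rw [toSet_eq_preimage v _ hv]
  congr 1
  have := (ofBox v I τ r h).sheared_self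
  refine this.trans ?_
  ext p
  simp only [box, ofBox, Set.mem_prod, Set.mem_preimage, Metric.mem_ball, Real.dist_eq, abs_lt,
    Set.mem_Ioo]
  refine and_congr_right fun _ => and_congr ?_ ?_ <;> constructor <;> intro h <;> linarith

/-- The height interval contributes at most one side, the slopes of `v` and of `Q.dir` at most d/η
sides each. -/
lemma abs_sub_le_of_mem_sheared {η : ℝ} (hη : 0 < η) {v : Dir d}
    (hv : η ≤ (v : E d) (Fin.last d)) {Q : Plate d} (hQ : η ≤ (Q.dir : E d) (Fin.last d))
    {p q : (Fin d → ℝ) × ℝ} (hp : p ∈ Q.sheared v) (hq : q ∈ Q.sheared v) :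
    |p.2 - q.2| ≤ (1 + 2 * (d / η)) * Q.basis.side := by
  have hx : ∀ i, |(p.1 - q.1) i| ≤ Q.basis.side := by
    intro i
    have h1 := hp.1 i
    have h2 := hq.1 i
    rw [Pi.sub_apply, abs_le]
    constructor <;> linarith [h1.1, h1.2, h2.1, h2.2]
  have h1 := abs_slope_le hη v hv hx
  have h2 := abs_slope_le hη Q.dir hQ hx
  have h3 := Q.subset_Icc hp.2
  have h4 := Q.subset_Icc hq.2
  have h5 := Q.length_le
  simp only [map_sub, Set.mem_Icc, abs_le] at h1 h2 h3 h4 ⊢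
  constructor <;> linarith [h1.1, h1.2, h2.1, h2.2, h3.1, h3.2, h4.1, h4.2]

end Plate

/-! ### From directional plates to the abstract system -/

lemma Cube.side_le_of_subset (hd : 1 ≤ d) {I J : Cube d} (h : I.toSet ⊆ J.toSet) :
    I.side ≤ J.side := by
  have := measure_mono (μ := volume) h
  rw [I.volume_toSet, J.volume_toSet,
    ENNReal.ofReal_le_ofReal_iff (pow_nonneg J.side_pos.le d)] at this
  exact le_of_pow_le_pow_left₀ (by omega) J.side_pos.le this

lemma mass_coe_finset (a : Plate d → ℝ≥0) (𝓛 : Finset (Plate d)) :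
    mass a (𝓛 : Set (Plate d)) = ∑ L ∈ 𝓛, (a L : ℝ≥0∞) :=
  Finset.tsum_subtype 𝓛 fun L => (a L : ℝ≥0∞)

/-- The Carleson condition, in the coordinates adapted to `v`. -/
lemma IsCarleson.sum_le_volume_boxes {η : ℝ} (hη : 0 < η) {V : Finset (Dir d)}
    (hV : ∀ v ∈ V, η ≤ (v : E d) (Fin.last d)) {𝒟 : Set (Cube d)}
    {a : Plate d → ℝ≥0} (ha : IsCarleson 𝒟 V a) (𝓛 : Finset (Plate d))
    (h𝓛 : ∀ Q ∈ 𝓛, Q ∈ dyadicPlates 𝒟 V) (v : Dir d) (hv : v ∈ V)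
    (𝒯 : Set (Cube d × ℝ × ℝ)) (h𝒯 : ∀ T ∈ 𝒯, 0 < T.2.2 ∧ 2 * T.2.2 ≤ T.1.side)
    (hsub : ∀ L ∈ 𝓛, ∃ T ∈ 𝒯, L.sheared v ⊆ box T.1 T.2.1 T.2.2) :
    ∑ L ∈ 𝓛, (a L : ℝ≥0∞) ≤ volume (⋃ T ∈ 𝒯, box T.1 T.2.1 T.2.2) := by
  have hv0 := hη.trans_le (hV v hv)
  set 𝒯' : Set (Plate d) := {T' | ∃ (T : Cube d × ℝ × ℝ) (hT : T ∈ 𝒯),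
    T' = Plate.ofBox v T.1 T.2.1 T.2.2 (h𝒯 T hT)} with h𝒯'
  have h := ha.mass_le v hv 𝒯' (by rintro _ ⟨T, hT, rfl⟩; rfl) (𝓛 : Set (Plate d))
    (fun L hL => h𝓛 L (Finset.mem_coe.1 hL)) (by
      intro L hL
      obtain ⟨T, hT, hLT⟩ := hsub L (Finset.mem_coe.1 hL)
      refine ⟨_, ⟨T, hT, rfl⟩, ?_⟩
      rw [Plate.toSet_ofBox v hv0, Plate.toSet_eq_preimage v _
        (hη.trans_le (hV _ (h𝓛 _ (Finset.mem_coe.1 hL)).1))]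
      exact Set.preimage_mono hLT)
  rw [mass_coe_finset] at h
  refine h.trans (le_trans (measure_mono ?_) (volume_shear_preimage_le v _))
  refine Set.iUnion₂_subset ?_
  rintro _ ⟨T, hT, rfl⟩
  rw [Plate.toSet_ofBox v hv0]
  exact Set.preimage_mono (Set.subset_biUnion_of_mem
    (u := fun T : Cube d × ℝ × ℝ => box T.1 T.2.1 T.2.2) hT)

/-- The system of plates given by a finite collection, in the coordinates adapted to `v`. -/
def plateSystem (hd : 1 ≤ d) {η : ℝ} (hη : 0 < η) {V : Finset (Dir d)}
    (hV : ∀ v ∈ V, η ≤ (v : E d) (Fin.last d)) {𝒟 : Set (Cube d)} (h𝒟 : IsDyadicGrid 𝒟)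
    {a : Plate d → ℝ≥0} (ha : IsCarleson 𝒟 V a) (𝓢 : Finset (Plate d))
    (h𝓢 : ∀ Q ∈ 𝓢, Q ∈ dyadicPlates 𝒟 V) (v : Dir d) (hv : v ∈ V) :
    PlateSystem d {Q // Q ∈ 𝓢} (1 + 2 * (d / η)) where
  base Q := Q.1.basis
  S Q := Q.1.sheared v
  a Q := a Q.1
  rect := Finset.univ.filter fun Q => Q.1.dir = v
  mid Q := Q.1.midK - slope v Q.1.basis.center
  rad Q := (Q.1.hi - Q.1.lo) / 2
  D_nonneg := by positivity
  meas Q := Q.1.measurableSet_sheared v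
  conv Q := by
    have := Plate.convex_sheared (v : E d) Q.1
    exact this
  fst_mem Q p hp := hp.1
  vol_ne_zero Q := by
    have h0 := hη.trans_le (hV _ (h𝓢 Q.1 Q.2).1)
    rw [Q.1.volume_sheared (v : E d) h0]; exact Q.1.volume_toSet_ne_zero h0
  vol_ne_top Q := by
    have h0 := hη.trans_le (hV _ (h𝓢 Q.1 Q.2).1)
    rw [Q.1.volume_sheared (v : E d) h0]; exact Q.1.volume_toSet_ne_top h0
  diam_le L R _ hLR p hp q hq := by
    refine (Plate.abs_sub_le_of_mem_sheared hη (hV v hv) (hV _ (h𝓢 L.1 L.2).1) hp hq).trans ?_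
    gcongr
    exact Cube.side_le_of_subset hd hLR
  carleson 𝓛 𝒯 h𝒯 hsub := by
    have h := ha.sum_le_volume_boxes hη hV (𝓛.map (Function.Embedding.subtype _)) (by
      intro L hL
      obtain ⟨L', _, rfl⟩ := Finset.mem_map.1 hL
      exact h𝓢 _ L'.2) v hv 𝒯 h𝒯 (by
      intro L hL
      obtain ⟨L', hL', rfl⟩ := Finset.mem_map.1 hL
      exact hsub L' hL')
    rwa [Finset.sum_map] at h
  rad_pos R _ := by linarith [R.1.lo_lt_hi]
  rad_le R _ := by linarith [R.1.length_le]
  rect_subset R hR p hp := by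
    obtain rfl : R.1.dir = v := (Finset.mem_filter.1 hR).2
    rw [Plate.sheared_self] at hp
    have := R.1.subset_Icc hp.2
    simp only [Plate.midK, abs_le]
    constructor <;> linarith [this.1, this.2]
  vol_rect R hR := by
    have h0 := hη.trans_le (hV _ (h𝓢 R.1 R.2).1)
    rw [R.1.volume_sheared (v : E d) h0, R.1.volume_toSet h0]
    congr 2
    ring
  nested R _ R' _ := h𝒟.nested _ (h𝓢 _ R.2).2 _ (h𝓢 _ R'.2).2

/-- The average over `R` of the balayage of the plates of `𝓢` whose bases lie below that of
`R`. -/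
def avgBelow (a : Plate d → ℝ≥0) (𝓢 : Finset (Plate d)) (R : Plate d) : ℝ≥0∞ :=
  ∑ L ∈ 𝓢 with L.basis.toSet ⊆ R.basis.toSet,
    a L / volume L.toSet * (volume (L.toSet ∩ R.toSet) / volume R.toSet)

/-- The plates of a fixed direction with a large average carry exponentially little mass. -/
theorem sum_large_avgBelow_le (hd : 1 ≤ d) {η : ℝ} (hη : 0 < η) {V : Finset (Dir d)}
    (hV : ∀ v ∈ V, η ≤ (v : E d) (Fin.last d)) {𝒟 : Set (Cube d)} (h𝒟 : IsDyadicGrid 𝒟)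
    {a : Plate d → ℝ≥0} (ha : IsCarleson 𝒟 V a) (𝓢 : Finset (Plate d))
    (h𝓢 : ∀ Q ∈ 𝓢, Q ∈ dyadicPlates 𝒟 V) (v : Dir d) (hv : v ∈ V) (k : ℕ) :
    ∑ R ∈ 𝓢.filter (fun R => R.dir = v) with
      ENNReal.ofReal (PlateSystem.bigThr d (1 + 2 * (d / η))) * (k + 1) < avgBelow a 𝓢 R,
      (a R : ℝ≥0∞) ≤ 2⁻¹ ^ k * ∑ L ∈ 𝓢, (a L : ℝ≥0∞) := by
  set P := plateSystem hd hη hV h𝒟 ha 𝓢 h𝓢 v hv with hP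
  have h := P.sum_large_avg_le k Finset.univ
  have hpos : ∀ Q : {Q // Q ∈ 𝓢}, 0 < (Q.1.dir : E d) (Fin.last d) := fun Q =>
    hη.trans_le (hV _ (h𝓢 Q.1 Q.2).1)
  have hS : ∀ Q, P.S Q = Q.1.sheared (v : E d) := fun Q => rfl
  have havg : ∀ R, P.avg Finset.univ R = avgBelow a 𝓢 R.1 := by
    intro R
    rw [PlateSystem.avg, PlateSystem.below, avgBelow, Finset.sum_filter, Finset.sum_filter,
      ← Finset.sum_coe_sort 𝓢, Finset.univ_eq_attach]
    refine Finset.sum_congr rfl fun L _ => ?_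
    have h1 : volume (P.S L) = volume L.1.toSet := by
      rw [hS, L.1.volume_sheared (v : E d) (hpos L)]
    have h2 : volume (P.S R) = volume R.1.toSet := by
      rw [hS, R.1.volume_sheared (v : E d) (hpos R)]
    have h3 : volume (P.S L ∩ P.S R) = volume (L.1.toSet ∩ R.1.toSet) := by
      rw [L.1.toSet_eq_preimage (v : E d) (hpos L), R.1.toSet_eq_preimage (v : E d) (hpos R),
        ← Set.preimage_inter, (measurePreserving_shear (v : E d)).measure_preimage
          ((L.1.measurableSet_sheared _).inter (R.1.measurableSet_sheared _)).nullMeasurableSet,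
        hS, hS]
    rw [PlateSystem.w, h1, h2, h3]
    rfl
  refine le_trans (le_of_eq ?_) (h.trans (le_of_eq ?_))
  · simp only [havg]
    rw [Finset.filter_filter, Finset.sum_filter, ← Finset.sum_coe_sort 𝓢]
    rw [show P.rect = Finset.univ.filter fun Q => Q.1.dir = v from rfl, Finset.filter_filter,
      Finset.sum_filter]
    rfl
  · congr 1
    exact Finset.sum_coe_sort 𝓢 fun L => (a L : ℝ≥0∞)

/-! ### Summing an exponentially decaying distribution -/

/-- A discrete layer-cake bound: each level exceeded from N on costs one Λ, and if every level is
exceeded the series is infinite. -/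
lemma le_add_tsum_indicator (Λ B : ℝ≥0∞) (hΛ : Λ ≠ 0) (N : ℕ) :
    B ≤ Λ * (N + 1) + ∑' k : ℕ, if Λ * ((N + k : ℕ) + 1) < B then Λ else 0 := by
  by_cases hall : ∀ k : ℕ, Λ * ((N + k : ℕ) + 1) < B
  · simp only [hall, if_true, ENNReal.tsum_const_eq_top_of_ne_zero hΛ]
    simp
  · push Not at hall
    have hfind := Nat.find_spec hall
    have hmin : ∀ k < Nat.find hall, Λ * ((N + k : ℕ) + 1) < B := fun k hk =>
      not_le.1 (Nat.find_min hall hk)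
    calc B ≤ Λ * ((N + Nat.find hall : ℕ) + 1) := hfind
      _ = Λ * (N + 1) + ∑ k ∈ Finset.range (Nat.find hall),
          if Λ * ((N + k : ℕ) + 1) < B then Λ else 0 := by
          rw [Finset.sum_congr rfl fun k hk => if_pos (hmin k (Finset.mem_range.1 hk))]
          simp only [Finset.sum_const, Finset.card_range, nsmul_eq_mul]
          push_cast
          ring
      _ ≤ _ := by
          gcongr
          exact ENNReal.sum_le_tsum _

/-- Summation of an exponentially decaying distribution. -/
lemma sum_mul_le_of_exp_decay {κ : Type*} (T : Finset κ) (a B : κ → ℝ≥0∞) (Λ m : ℝ≥0∞)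
    (hΛ : Λ ≠ 0) (h : ∀ k : ℕ, ∑ R ∈ T with Λ * (k + 1) < B R, a R ≤ 2⁻¹ ^ k * m) (N : ℕ) :
    ∑ R ∈ T, a R * B R ≤ Λ * (N + 1) * ∑ R ∈ T, a R + 2 * Λ * 2⁻¹ ^ N * m := by
  calc ∑ R ∈ T, a R * B R
      ≤ ∑ R ∈ T, a R * (Λ * (N + 1) + ∑' k : ℕ, if Λ * ((N + k : ℕ) + 1) < B R then Λ else 0) :=
        Finset.sum_le_sum fun R _ => mul_le_mul_right (le_add_tsum_indicator Λ (B R) hΛ N) _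
    _ = Λ * (N + 1) * ∑ R ∈ T, a R +
        ∑' k : ℕ, Λ * ∑ R ∈ T with Λ * ((N + k : ℕ) + 1) < B R, a R := by
        rw [Finset.mul_sum, Finset.sum_congr rfl fun R _ => mul_add (a R) _ _,
          Finset.sum_add_distrib]
        congr 1
        · exact Finset.sum_congr rfl fun R _ => mul_comm _ _
        · simp only [← ENNReal.tsum_mul_left]
          rw [← Summable.tsum_finsetSum fun _ _ => ENNReal.summable]
          refine tsum_congr fun k => ?_
          rw [Finset.mul_sum, Finset.sum_filter]
          refine Finset.sum_congr rfl fun R _ => ?_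
          split_ifs <;> simp [mul_comm]
    _ ≤ Λ * (N + 1) * ∑ R ∈ T, a R + ∑' k : ℕ, Λ * (2⁻¹ ^ N * m) * 2⁻¹ ^ k := by
        refine add_le_add_right (ENNReal.tsum_le_tsum fun k => ?_) _
        rw [mul_assoc]
        refine mul_le_mul_right ((h (N + k)).trans (le_of_eq ?_)) _
        rw [pow_add]
        ring
    _ = _ := by
        rw [ENNReal.tsum_mul_left, ENNReal.tsum_geometric, ENNReal.one_sub_inv_two, inv_inv]
        ring

/-! ### The square estimate for finite collections -/

/-- The balayage of a finite collection. -/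
def finBalayage (a : Plate d → ℝ≥0) (𝓢 : Finset (Plate d)) (x : E d) : ℝ≥0∞ :=
  ∑ Q ∈ 𝓢, Q.toSet.indicator (fun _ => (a Q : ℝ≥0∞) / volume Q.toSet) x

lemma measurable_finBalayage (a : Plate d → ℝ≥0) (𝓢 : Finset (Plate d))
    (h𝓢 : ∀ Q ∈ 𝓢, 0 < (Q.dir : E d) (Fin.last d)) : Measurable (finBalayage a 𝓢) :=
  Finset.measurable_sum _ fun Q hQ =>
    measurable_const.indicator (Q.measurableSet_toSet (h𝓢 Q hQ))

lemma lintegral_finBalayage_sq_eq (a : Plate d → ℝ≥0) (𝓢 : Finset (Plate d))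
    (h𝓢 : ∀ Q ∈ 𝓢, 0 < (Q.dir : E d) (Fin.last d)) :
    ∫⁻ x, finBalayage a 𝓢 x ^ 2 = ∑ R ∈ 𝓢, ∑ Q ∈ 𝓢,
      (a R / volume R.toSet) * (a Q / volume Q.toSet) * volume (Q.toSet ∩ R.toSet) := by
  have hpt : ∀ x, finBalayage a 𝓢 x ^ 2 = ∑ R ∈ 𝓢, ∑ Q ∈ 𝓢, (Q.toSet ∩ R.toSet).indicator
      (fun _ => (a R / volume R.toSet) * (a Q / volume Q.toSet)) x := by
    intro x
    rw [sq, finBalayage, Finset.sum_mul_sum]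
    refine Finset.sum_congr rfl fun R _ => Finset.sum_congr rfl fun Q _ => ?_
    by_cases h1 : x ∈ R.toSet <;> by_cases h2 : x ∈ Q.toSet <;> simp [h1, h2]
  have hm : ∀ R ∈ 𝓢, ∀ Q ∈ 𝓢, MeasurableSet (Q.toSet ∩ R.toSet) := fun R hR Q hQ =>
    (Q.measurableSet_toSet (h𝓢 Q hQ)).inter (R.measurableSet_toSet (h𝓢 R hR))
  simp only [hpt]
  rw [lintegral_finsetSum _ fun R hR => Finset.measurable_sum _ fun Q hQ =>
    measurable_const.indicator (hm R hR Q hQ)]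
  refine Finset.sum_congr rfl fun R hR => ?_
  rw [lintegral_finsetSum _ fun Q hQ => measurable_const.indicator (hm R hR Q hQ)]
  refine Finset.sum_congr rfl fun Q hQ => ?_
  rw [lintegral_indicator_const (hm R hR Q hQ)]

lemma Plate.proj_mem {Q : Plate d} {x : E d} (hx : x ∈ Q.toSet) : proj x ∈ Q.basis.toSet := by
  simp only [Plate.toSet, Set.mem_iUnion] at hx
  obtain ⟨t, _, hx⟩ := hx
  exact hx.2

/-- Plates that meet have projections that meet, hence nested bases; each such pair is charged to
the plate with the larger basis. -/
lemma lintegral_finBalayage_sq_le {V : Finset (Dir d)} {𝒟 : Set (Cube d)} (h𝒟 : IsDyadicGrid 𝒟)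
    (a : Plate d → ℝ≥0) (𝓢 : Finset (Plate d)) (h𝓢 : ∀ Q ∈ 𝓢, Q ∈ dyadicPlates 𝒟 V)
    (hpos : ∀ Q ∈ 𝓢, 0 < (Q.dir : E d) (Fin.last d)) :
    ∫⁻ x, finBalayage a 𝓢 x ^ 2 ≤ 2 * ∑ R ∈ 𝓢, a R * avgBelow a 𝓢 R := by
  rw [lintegral_finBalayage_sq_eq a 𝓢 hpos]
  set b : Plate d → Plate d → ℝ≥0∞ := fun R Q =>
    (a R / volume R.toSet) * (a Q / volume Q.toSet) * volume (Q.toSet ∩ R.toSet) with hb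
  set c : Plate d → Plate d → ℝ≥0∞ := fun R Q =>
    if Q.basis.toSet ⊆ R.basis.toSet then b R Q else 0 with hc
  have hsymm : ∀ R Q, b R Q = b Q R := by
    intro R Q
    simp only [hb]
    rw [Set.inter_comm, mul_comm (_ / _ : ℝ≥0∞)]
  have hle : ∀ R ∈ 𝓢, ∀ Q ∈ 𝓢, b R Q ≤ c R Q + c Q R := by
    intro R hR Q hQ
    by_cases hne : (Q.toSet ∩ R.toSet).Nonempty
    · obtain ⟨x, hxQ, hxR⟩ := hne
      rcases h𝒟.nested _ (h𝓢 Q hQ).2 _ (h𝓢 R hR).2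
        ⟨proj x, Plate.proj_mem hxQ, Plate.proj_mem hxR⟩ with h | h
      · simp only [hc, if_pos h]; exact le_self_add
      · simp only [hc, if_pos h, hsymm Q R]; exact le_add_self
    · have : b R Q = 0 := by
        simp [hb, Set.not_nonempty_iff_eq_empty.1 hne]
      rw [this]; exact zero_le
  have havg : ∀ R, ∑ Q ∈ 𝓢, c R Q = a R * avgBelow a 𝓢 R := by
    intro R
    rw [avgBelow, Finset.mul_sum, Finset.sum_filter]
    refine Finset.sum_congr rfl fun Q _ => ?_
    simp only [hc, hb]
    split_ifs
    · simp only [div_eq_mul_inv]; ring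
    · rfl
  calc ∑ R ∈ 𝓢, ∑ Q ∈ 𝓢, b R Q ≤ ∑ R ∈ 𝓢, ∑ Q ∈ 𝓢, (c R Q + c Q R) :=
        Finset.sum_le_sum fun R hR => Finset.sum_le_sum fun Q hQ => hle R hR Q hQ
    _ = (∑ R ∈ 𝓢, ∑ Q ∈ 𝓢, c R Q) + ∑ Q ∈ 𝓢, ∑ R ∈ 𝓢, c Q R := by
        simp only [Finset.sum_add_distrib]
        congr 1
        exact Finset.sum_comm
    _ = _ := by simp only [havg, two_mul]

/-- N is log₂ n rounded up; since log n ≥ log 2, the factor 8 absorbs the rounding and the summand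
3. -/
lemma exists_nat_log {n : ℕ} (hn : 2 ≤ n) :
    ∃ N : ℕ, n ≤ 2 ^ N ∧ (N : ℝ) + 3 ≤ 8 * Real.log n := by
  have hlog2 := Real.log_two_gt_d9
  have hn' : (2 : ℝ) ≤ n := by exact_mod_cast hn
  have hlog : Real.log 2 ≤ Real.log n := Real.log_le_log (by norm_num) hn'
  have h0 : 0 ≤ Real.log n / Real.log 2 := by positivity
  refine ⟨⌈Real.log n / Real.log 2⌉₊, ?_, ?_⟩
  · have h1 := Nat.le_ceil (Real.log n / Real.log 2)
    rw [div_le_iff₀ (by linarith), ← Real.log_pow,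
      Real.log_le_log_iff (by linarith) (by positivity)] at h1
    exact_mod_cast h1
  · have h1 := (Nat.ceil_lt_add_one h0).le
    have h2 : Real.log n / Real.log 2 ≤ Real.log n * 2 - Real.log n * (1 / 2) := by
      rw [div_le_iff₀ (by linarith)]
      nlinarith
    linarith

/-- The square function estimate for finite collections. -/
theorem lintegral_finBalayage_sq_le_log (hd : 1 ≤ d) {η : ℝ} (hη : 0 < η) {V : Finset (Dir d)}
    (hcard : 2 ≤ V.card) (hV : ∀ v ∈ V, η ≤ (v : E d) (Fin.last d)) {𝒟 : Set (Cube d)}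
    (h𝒟 : IsDyadicGrid 𝒟) {a : Plate d → ℝ≥0} (ha : IsCarleson 𝒟 V a) (𝓢 : Finset (Plate d))
    (h𝓢 : ∀ Q ∈ 𝓢, Q ∈ dyadicPlates 𝒟 V) :
    ∫⁻ x, finBalayage a 𝓢 x ^ 2 ≤
      ENNReal.ofReal (16 * PlateSystem.bigThr d (1 + 2 * (d / η))) *
        ENNReal.ofReal (Real.log V.card) * ∑ Q ∈ 𝓢, (a Q : ℝ≥0∞) := by
  have hpos : ∀ Q ∈ 𝓢, 0 < (Q.dir : E d) (Fin.last d) := fun Q hQ =>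
    hη.trans_le (hV _ (h𝓢 Q hQ).1)
  have hb : 0 < PlateSystem.bigThr d (1 + 2 * (d / η)) := by
    unfold PlateSystem.bigThr PlateSystem.thr; positivity
  set Λ := ENNReal.ofReal (PlateSystem.bigThr d (1 + 2 * (d / η))) with hΛ
  have hΛ0 : Λ ≠ 0 := by rw [hΛ, ← pos_iff_ne_zero, ENNReal.ofReal_pos]; exact hb
  set m := ∑ Q ∈ 𝓢, (a Q : ℝ≥0∞) with hm
  obtain ⟨N, hN1, hN2⟩ := exists_nat_log hcard
  have hfib : ∀ g : Plate d → ℝ≥0∞,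
      ∑ v ∈ V, ∑ R ∈ 𝓢.filter (fun R => R.dir = v), g R = ∑ R ∈ 𝓢, g R := fun g =>
    Finset.sum_fiberwise_of_maps_to (fun R hR => (h𝓢 R hR).1) g
  -- Each direction's tail is bounded by the full mass `m`, not by its own share, so 2^{-N} has to
  -- offset the number of directions.
  have hVN : (V.card : ℝ≥0∞) * 2⁻¹ ^ N ≤ 1 := by
    rw [← ENNReal.inv_pow, ← div_eq_mul_inv]
    refine ENNReal.div_le_of_le_mul ?_
    rw [one_mul]
    exact_mod_cast hN1
  have hNlog : (N : ℝ≥0∞) + 3 ≤ ENNReal.ofReal (8 * Real.log V.card) := by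
    refine le_trans (le_of_eq ?_) (ENNReal.ofReal_le_ofReal hN2)
    rw [ENNReal.ofReal_add (by positivity) (by norm_num), ENNReal.ofReal_natCast,
      ENNReal.ofReal_ofNat]
  calc ∫⁻ x, finBalayage a 𝓢 x ^ 2
      ≤ 2 * ∑ R ∈ 𝓢, a R * avgBelow a 𝓢 R := lintegral_finBalayage_sq_le h𝒟 a 𝓢 h𝓢 hpos
    _ = 2 * ∑ v ∈ V, ∑ R ∈ 𝓢.filter (fun R => R.dir = v), a R * avgBelow a 𝓢 R := by
        rw [hfib]
    _ ≤ 2 * ∑ v ∈ V, (Λ * (N + 1) * ∑ R ∈ 𝓢.filter (fun R => R.dir = v), (a R : ℝ≥0∞) +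
          2 * Λ * 2⁻¹ ^ N * m) := by
        gcongr with v hv
        exact sum_mul_le_of_exp_decay _ (fun R => (a R : ℝ≥0∞)) _ Λ m hΛ0
          (fun k => sum_large_avgBelow_le hd hη hV h𝒟 ha 𝓢 h𝓢 v hv k) N
    _ = 2 * (Λ * (N + 1) * m + 2 * Λ * (V.card * 2⁻¹ ^ N) * m) := by
        rw [Finset.sum_add_distrib, ← Finset.mul_sum, hfib, Finset.sum_const, nsmul_eq_mul]
        ring
    _ ≤ 2 * (Λ * (N + 1) * m + 2 * Λ * 1 * m) := by gcongr
    _ = 2 * Λ * (N + 3) * m := by ring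
    _ ≤ 2 * Λ * ENNReal.ofReal (8 * Real.log V.card) * m := by gcongr
    _ = _ := by
        rw [ENNReal.ofReal_mul (by norm_num : (0 : ℝ) ≤ 8),
          ENNReal.ofReal_mul (by norm_num : (0 : ℝ) ≤ 16), ENNReal.ofReal_ofNat,
          ENNReal.ofReal_ofNat]
        ring

/-! ### Infinite collections and conclusion -/

/-- A bound for all finite subcollections passes to the whole collection. -/
lemma lintegral_balayage_sq_le {a : Plate d → ℝ≥0} {𝒬 : Set (Plate d)}
    (hpos : ∀ Q ∈ 𝒬, 0 < (Q.dir : E d) (Fin.last d)) (hfin : mass a 𝒬 ≠ ∞) {c : ℝ≥0∞}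
    (h : ∀ 𝓢 : Finset (Plate d), (𝓢 : Set (Plate d)) ⊆ 𝒬 →
      ∫⁻ x, finBalayage a 𝓢 x ^ 2 ≤ c * ∑ Q ∈ 𝓢, (a Q : ℝ≥0∞)) :
    ∫⁻ x, balayage a 𝒬 x ^ 2 ≤ c * mass a 𝒬 := by
  -- The collection may be uncountable, as heights are arbitrary intervals; finite mass leaves only
  -- countably many nonzero terms, as monotone convergence requires.
  set s : Set 𝒬 := Function.support fun Q : 𝒬 => (a Q : ℝ≥0∞) with hs
  have hcount : s.Countable := Summable.countable_support_ennreal hfin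
  have : Countable s := hcount.to_subtype
  set e : s ↪ Plate d := ⟨fun Q => Q.1.1, fun Q Q' hQ => Subtype.ext (Subtype.ext hQ)⟩ with he
  have hsub : ∀ F : Finset s, ((F.map e : Finset (Plate d)) : Set (Plate d)) ⊆ 𝒬 := by
    intro F Q hQ
    obtain ⟨Q', _, rfl⟩ := Finset.mem_map.1 (Finset.mem_coe.1 hQ)
    exact Q'.1.2
  have hbal : ∀ x, balayage a 𝒬 x = ⨆ F : Finset s, finBalayage a (F.map e) x := by
    intro x
    rw [balayage, ← tsum_subtype_eq_of_support_subset (s := s), ENNReal.tsum_eq_iSup_sum]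
    · simp only [finBalayage, Finset.sum_map]
      rfl
    · intro Q hQ
      contrapose! hQ
      have h0 : (a Q : ℝ≥0∞) = 0 := Function.notMem_support.1 hQ
      simp [h0]
  simp only [hbal, ENNReal.iSup_pow]
  rw [lintegral_iSup_directed]
  · refine iSup_le fun F => (h _ (hsub F)).trans ?_
    gcongr
    rw [Finset.sum_map]
    calc ∑ Q ∈ F, (a (e Q) : ℝ≥0∞) ≤ ∑' Q : s, (a Q.1 : ℝ≥0∞) := ENNReal.sum_le_tsum F
      _ ≤ mass a 𝒬 := ENNReal.tsum_comp_le_tsum_of_injective Subtype.val_injective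
          (fun Q : 𝒬 => (a Q : ℝ≥0∞))
  · intro F
    exact ((measurable_finBalayage a _ fun Q hQ => hpos Q (hsub F hQ)).pow_const 2).aemeasurable
  · refine Monotone.directed_le fun F F' hFF' x => ?_
    have : finBalayage a (F.map e) x ≤ finBalayage a (F'.map e) x :=
      Finset.sum_le_sum_of_subset (Finset.map_subset_map.2 hFF')
    simp only
    gcongr

end PlateCarleson

end

theorem theorem7p1 (d : ℕ) (hd : 1 ≤ d) (η : ℝ) (hη : 0 < η) (A : ℝ≥0) :
    ∃ C : ℝ≥0, ∀ (V : Finset (PlateCarleson.Dir d)), 2 ≤ V.card →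
      (∀ v ∈ V, η ≤ (v : PlateCarleson.E d) (Fin.last d)) →
      ∀ (𝒟 : Set (PlateCarleson.Cube d)), PlateCarleson.IsDyadicGrid 𝒟 →
      ∀ 𝒬 ⊆ PlateCarleson.dyadicPlates 𝒟 V,
      (∀ v ∈ V, PlateCarleson.WeakTypeOneOne
        (PlateCarleson.maximalOp (PlateCarleson.hat (PlateCarleson.withDir 𝒬 v))) A) →
      ∀ (a : PlateCarleson.Plate d → ℝ≥0), PlateCarleson.IsCarleson 𝒟 V a →
        eLpNorm (PlateCarleson.balayage a 𝒬) 2 volume ≤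
          C * ENNReal.ofReal (Real.log V.card ^ (1 / 2 : ℝ)) *
            PlateCarleson.mass a 𝒬 ^ (1 / 2 : ℝ) := by
  set Λ : ℝ := 16 * PlateCarleson.PlateSystem.bigThr d (1 + 2 * (d / η)) with hΛ
  refine ⟨Real.toNNReal Λ ^ (1 / 2 : ℝ), ?_⟩
  -- The Carleson condition, tested on unions of plates, makes the weak type bound superfluous.
  intro V hcard hV 𝒟 h𝒟 𝒬 h𝒬 _ a ha
  have hfin : PlateCarleson.mass a 𝒬 ≠ ∞ := by
    refine ne_top_of_le_ne_top ha.mass_lt_top.ne ?_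
    exact ENNReal.tsum_mono_subtype (fun Q => (a Q : ℝ≥0∞)) h𝒬
  have h := PlateCarleson.lintegral_balayage_sq_le (a := a) (𝒬 := 𝒬)
    (fun Q hQ => hη.trans_le (hV _ (h𝒬 hQ).1)) hfin
    (fun 𝓢 h𝓢 => PlateCarleson.lintegral_finBalayage_sq_le_log hd hη hcard hV h𝒟 ha 𝓢
      fun Q hQ => h𝒬 (h𝓢 hQ))
  have hlog : 0 ≤ Real.log V.card := Real.log_natCast_nonneg _
  have hhalf : (0 : ℝ) ≤ 1 / 2 := by norm_num
  calc eLpNorm (PlateCarleson.balayage a 𝒬) 2 volume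
      = (∫⁻ x, PlateCarleson.balayage a 𝒬 x ^ 2) ^ (1 / 2 : ℝ) := by
        rw [eLpNorm_eq_lintegral_rpow_enorm_toReal (by norm_num) (by norm_num)]
        simp
    _ ≤ (ENNReal.ofReal Λ * ENNReal.ofReal (Real.log V.card) *
          PlateCarleson.mass a 𝒬) ^ (1 / 2 : ℝ) := ENNReal.rpow_le_rpow h hhalf
    _ = _ := by
        rw [ENNReal.mul_rpow_of_nonneg _ _ hhalf, ENNReal.mul_rpow_of_nonneg _ _ hhalf,
          ENNReal.ofReal_rpow_of_nonneg hlog hhalf, ENNReal.coe_rpow_of_nonneg _ hhalf]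
        rfl
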